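/- A complex torus of dimension $g$ is a quotient $T=V/\Lambda$, where $V$ is a $g$-dimensional complex vector space and $\Lambda\subset V$ is a discrete subgroup of rank $2g$. Let $\mathrm{End}(T)$ be the ring of endomorphisms of the complex Lie group $T$, $\mathrm{End}^0(T)=\mathrm{End}(T)\otimes_{\mathbb Z}\mathbb Q$, and $\mathrm{Aut}(T)=\mathrm{End}(T)^{*}$. For $g\ge 2$, the torus $T$ is called $2$-simple if for every rational Hodge substructure $H$ of $\mathrm{H}^2(T,\mathbb Q)$ such that $H_{\mathbb C}\cap \mathrm{H}^{2,0}(T)\neq\{0\}$, where $H_{\mathbb C}=H\otimes_{\mathbb Q}\mathbb C$, one has $\mathrm{H}^{2,0}(T)\subset H_{\mathbb C}$. **Theorem.** Let $g\ge 3$ be an integer. (a) Let $r,s$ be nonnegative integers such that $r+2s=g$. Then there exists a $2$-simple complex torus $T$ of dimension $g$ whose endomorphism algebra $\mathrm{End}^0(T)$ is (isomorphic to) a number field $E$ of degree $[E:\mathbb Q]=g$ that has exactly $r$ real embeddings and exactly $s$ pairs of complex conjugate non-real embeddings. (b) In particular, if $d$ is an integer such that $\frac g2-1\le d\le g-1$,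 then there exists a $g$-dimensional $2$-simple complex torus $T$ such that $\mathrm{Aut}(T)\cong\mathbb Z^{d}\times\{\pm1\}$. -/

import Mathlib

open scoped TensorProduct

/-- A complex torus `V / Λ`: a finite-dimensional complex vector space `V` together with a
discrete subgroup `Λ` that spans `V` over `ℝ` (so that `Λ` has rank `2 * dim V`). -/
structure ComplexTorus where
  /-- The universal covering space. -/
  V : Type
  [normedAddCommGroup : NormedAddCommGroup V]
  [normedSpace : NormedSpace ℂ V]
  [finiteDimensional : FiniteDimensional ℂ V]
  /-- The lattice. -/
  Λ : Submodule ℤ V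
  [discreteTopology : DiscreteTopology Λ]
  [isZLattice : IsZLattice ℝ Λ]

namespace ComplexTorus

attribute [instance] normedAddCommGroup normedSpace finiteDimensional discreteTopology isZLattice

/-- The complex dimension of the torus. -/
noncomputable def dim (T : ComplexTorus) : ℕ := Module.finrank ℂ T.V

/-- The underlying commutative group `V / Λ` of the torus. -/
abbrev Pt (T : ComplexTorus) : Type := T.V ⧸ T.Λ

/-- The projection `V → V / Λ`. -/
abbrev proj (T : ComplexTorus) : T.V →ₗ[ℤ] T.Pt := T.Λ.mkQ

/-- A map `f : T → T` is holomorphic if locally it lifts to a holomorphic map `V → V`. (The charts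
of `T = V / Λ` are the local inverses of the projection `V → T`.) -/
def IsHolomorphic (T : ComplexTorus) (f : T.Pt → T.Pt) : Prop :=
  ∀ x : T.V, ∃ U : Set T.V, IsOpen U ∧ x ∈ U ∧
    ∃ F : T.V → T.V, DifferentiableOn ℂ F U ∧ ∀ y ∈ U, T.proj (F y) = f (T.proj y)

/-- The ring `End(T)` of endomorphisms of the complex Lie group `T`: the holomorphic group
endomorphisms of `T`, with pointwise addition and composition. -/
def endRing (T : ComplexTorus) : Subring (AddMonoid.End T.Pt) where
  carrier := {f | T.IsHolomorphic f}
  zero_mem' := fun x => ⟨Set.univ, isOpen_univ, Set.mem_univ x, fun _ => 0,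
    differentiableOn_const 0, fun y _ => by simp⟩
  one_mem' := fun x => ⟨Set.univ, isOpen_univ, Set.mem_univ x, id,
    differentiableOn_id, fun y _ => rfl⟩
  add_mem' := by
    intro f g hf hg x
    obtain ⟨U, hU, hxU, F, hF, hFf⟩ := hf x
    obtain ⟨W, hW, hxW, G, hG, hGg⟩ := hg x
    refine ⟨U ∩ W, hU.inter hW, ⟨hxU, hxW⟩, fun y => F y + G y,
      (hF.mono Set.inter_subset_left).add (hG.mono Set.inter_subset_right), ?_⟩
    intro y hy
    rw [map_add, hFf y hy.1, hGg y hy.2]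
    rfl
  neg_mem' := by
    intro f hf x
    obtain ⟨U, hU, hxU, F, hF, hFf⟩ := hf x
    refine ⟨U, hU, hxU, fun y => -F y, hF.neg, ?_⟩
    intro y hy
    rw [map_neg, hFf y hy]
    rfl
  mul_mem' := by
    intro f g hf hg x
    obtain ⟨W, hW, hxW, G, hG, hGg⟩ := hg x
    obtain ⟨U, hU, hxU, F, hF, hFf⟩ := hf (G x)
    refine ⟨W ∩ G ⁻¹' U, hG.continuousOn.isOpen_inter_preimage hW hU, ⟨hxW, hxU⟩, F ∘ G,
      hF.comp (hG.mono Set.inter_subset_left) (fun y hy => hy.2), ?_⟩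
    intro y hy
    rw [Function.comp_apply, hFf _ hy.2, hGg y hy.1]
    rfl

/-- The endomorphism algebra `End⁰(T) = End(T) ⊗ ℚ`, a `ℚ`-algebra. -/
abbrev endAlg (T : ComplexTorus) : Type := ℚ ⊗[ℤ] T.endRing

/-- The automorphism group `Aut(T) = End(T)ˣ` of the complex Lie group `T`. -/
abbrev autGroup (T : ComplexTorus) : Type := (T.endRing)ˣ

/-- The second complex cohomology group `H²(T, ℂ)`, realized as the space of `ℂ`-valued
`ℝ`-bilinear alternating forms on `V = Λ ⊗ ℝ` (equivalently, `ℂ`-bilinear alternating forms on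
`Λ ⊗ ℂ`). -/
abbrev H2C (T : ComplexTorus) : Type := T.V [⋀^Fin 2]→ₗ[ℝ] ℂ

/-- The second rational cohomology group `H²(T, ℚ) = Hom(⋀² (Λ ⊗ ℚ), ℚ)`, as the `ℚ`-subspace of
`H²(T, ℂ)` that consists of the forms with rational values on `Λ`. -/
def H2Q (T : ComplexTorus) : Submodule ℚ T.H2C where
  carrier := {ω | ∀ a ∈ T.Λ, ∀ b ∈ T.Λ, ∃ q : ℚ, ω ![a, b] = (q : ℂ)}
  zero_mem' := fun a _ b _ => ⟨0, by simp⟩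
  add_mem' := by
    intro ω η hω hη a ha b hb
    obtain ⟨p, hp⟩ := hω a ha b hb
    obtain ⟨q, hq⟩ := hη a ha b hb
    exact ⟨p + q, by rw [AlternatingMap.add_apply, hp, hq]; push_cast; rfl⟩
  smul_mem' := by
    intro c ω hω a ha b hb
    obtain ⟨p, hp⟩ := hω a ha b hb
    exact ⟨c * p, by rw [AlternatingMap.smul_apply, hp, Rat.smul_def]; push_cast; rfl⟩

/-- The Hodge component `H^{2,0}(T)`: the holomorphic (that is, `ℂ`-bilinear) `2`-forms. -/
def H20 (T : ComplexTorus) : Submodule ℂ T.H2C where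
  carrier := {ω | ∀ v w : T.V, ω ![Complex.I • v, w] = Complex.I * ω ![v, w]}
  zero_mem' := fun v w => by simp
  add_mem' := by
    intro ω η hω hη v w
    rw [AlternatingMap.add_apply, AlternatingMap.add_apply, hω v w, hη v w, mul_add]
  smul_mem' := by
    intro c ω hω v w
    rw [AlternatingMap.smul_apply, AlternatingMap.smul_apply, hω v w, smul_eq_mul, smul_eq_mul,
      mul_left_comm]

/-- The Hodge component `H^{0,2}(T)`: the forms that are `ℂ`-antilinear in each argument. -/
def H02 (T : ComplexTorus) : Submodule ℂ T.H2C where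
  carrier := {ω | ∀ v w : T.V, ω ![Complex.I • v, w] = -Complex.I * ω ![v, w]}
  zero_mem' := fun v w => by simp
  add_mem' := by
    intro ω η hω hη v w
    rw [AlternatingMap.add_apply, AlternatingMap.add_apply, hω v w, hη v w, mul_add]
  smul_mem' := by
    intro c ω hω v w
    rw [AlternatingMap.smul_apply, AlternatingMap.smul_apply, hω v w, smul_eq_mul, smul_eq_mul,
      mul_left_comm]

/-- The Hodge component `H^{1,1}(T)`: the forms that are invariant under multiplication by `i`
(which acts on `H^{2,0}(T)` and `H^{0,2}(T)` as `-1`). -/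
def H11 (T : ComplexTorus) : Submodule ℂ T.H2C where
  carrier := {ω | ∀ v w : T.V, ω ![Complex.I • v, Complex.I • w] = ω ![v, w]}
  zero_mem' := fun v w => by simp
  add_mem' := by
    intro ω η hω hη v w
    rw [AlternatingMap.add_apply, AlternatingMap.add_apply, hω v w, hη v w]
  smul_mem' := by
    intro c ω hω v w
    rw [AlternatingMap.smul_apply, AlternatingMap.smul_apply, hω v w]

/-- The complexification `H_ℂ ⊆ H²(T, ℂ)` of a `ℚ`-subspace `H ⊆ H²(T, ℚ)`. -/
noncomputable def complexify (T : ComplexTorus) (H : Submodule ℚ T.H2C) : Submodule ℂ T.H2C :=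
  Submodule.span ℂ (H : Set T.H2C)

/-- `H` is a rational Hodge substructure of `H²(T, ℚ)`: a `ℚ`-subspace such that `H_ℂ` is the
(automatically direct) sum of its intersections with the Hodge components of `H²(T, ℂ)`. -/
def IsHodgeSubstructure (T : ComplexTorus) (H : Submodule ℚ T.H2C) : Prop :=
  H ≤ T.H2Q ∧
    T.complexify H =
      (T.complexify H ⊓ T.H20) ⊔ (T.complexify H ⊓ T.H11) ⊔ (T.complexify H ⊓ T.H02)

/-- `T` is `2`-simple: if the complexification of a rational Hodge substructure of `H²(T, ℚ)`
meets `H^{2,0}(T)` nontrivially, then it contains `H^{2,0}(T)`. (A notion for `dim T ≥ 2`.) -/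
def IsTwoSimple (T : ComplexTorus) : Prop :=
  ∀ H : Submodule ℚ T.H2C, T.IsHodgeSubstructure H →
    T.complexify H ⊓ T.H20 ≠ ⊥ → T.H20 ≤ T.complexify H

end ComplexTorus

/-!
Let `E` be a number field of degree `g ≥ 3`, let `𝓞` be its ring of integers, and let `v` be a unit
of `E ⊗ ℝ`. Then `𝓞 + i v 𝓞` is a lattice in `E ⊗ ℂ = ℂ ^ g`, and the quotient by it is a complex
torus `T` with multiplication by `𝓞`. The rational homology of `T` is `E ⊕ i v E = E ^ 2`, on which
`𝔰𝔩₂(E)` acts through the operators `raise x : a + i v b ↦ x b` and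
`lower x : a + i v b ↦ i v x a`. If `v = ∑ vₖ ωₖ` and `v⁻¹ = ∑ wₖ ωₖ` in an integral basis `(ωₖ)`,
then the complex structure of `T` is `i = ∑ wₖ lower ωₖ - ∑ vₖ raise ωₖ`
(`GenericUnit.I_smul_eq_sum_lower_raise`). The unit is chosen in such a way that the `2 g` real
numbers `vₖ`, `wₖ` are linearly independent over `ℚ` (`exists_genericUnit`). Then every rational
structure that is stable under `i` is stable under all `raise x` and `lower x`. There are two
applications.

* An endomorphism of `T` lifts to a complex-linear map that preserves the lattice
  (`ComplexTorus.exists_linear_lift`), and comparing the coefficients of `vₖ` and `wₖ` shows that it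
  is the multiplication by an element of `𝓞`. Hence `End(T) = 𝓞` (`GenericUnit.endRingEquiv`).
* A rational Hodge substructure `H` of `H²(T, ℚ)` is stable under `𝔰𝔩₂(E)`, because its
  complexification is stable under the derivation that is induced by `i`
  (`GenericUnit.isStable_of_I_stable`).

For the `2`-simplicity, the field `E` is chosen with a doubly transitive Galois group, in the form
that `E ⊗ E` has a quotient field `L` of degree `g (g - 1)` (`IsPairField`). Then `E ⊗ E = E × L`,
and the antisymmetric functionals on `E ⊗ E` form a one-dimensional vector space over `L`
(`IsPairField.exists_eq_mul`). If `H_ℂ` contains a nonzero form of type `(2, 0)`, then some `h` in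
`H` does not vanish on `E`, as `E` spans `E ⊗ ℂ` over `ℂ`. The forms `raise y (raise x h)` are the
multiples by `x ⊗ y` of the antisymmetric functional given by `h`, so `H` contains all forms
`φ (b, b')` with `φ` antisymmetric on `E`, and by means of `lower` also the forms
`φ (a, b') - φ (a', b)` and `φ (a, a')`, as well as their twists by elements of `E`. The forms of
type `(2, 0)` are complex combinations of these
(`GenericUnit.IsStable.mem_span_of_holomorphic`).

The field `E` is generated by a root of a polynomial that is irreducible modulo `2`, is the product
of `X` and an irreducible polynomial modulo `3`, and is close to a polynomial with given numbers of
real and non-real roots (`exists_polynomial`). By Hensel's lemma it has a root `α` in `ℚ₃` with an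
irreducible cofactor of `X - α`, whence `L` (`exists_numberField`).

A root of unity in such a field `E` is rational (`IsPairField.mem_range_of_pow_eq_one`). So
Dirichlet's unit theorem gives `Aut(T) = 𝓞ˣ = ℤ ^ (r + s - 1) × {±1}`, and all integers `d` with
`g / 2 - 1 ≤ d ≤ g - 1` are of the form `r + s - 1`.
-/

/-! ### The tensor square of a field -/

section TensorSquare

variable {E L : Type*} [Field E] [Algebra ℚ E] [Field L] [Algebra ℚ L]

/-- The swap `x ⊗ y ↦ y ⊗ x` of the tensor square of a field. -/
noncomputable abbrev tensorSwap (E : Type*) [Field E] [Algebra ℚ E] :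
    E ⊗[ℚ] E ≃ₐ[ℚ] E ⊗[ℚ] E :=
  Algebra.TensorProduct.comm ℚ E E

theorem tensorSwap_swap (r : E ⊗[ℚ] E) : tensorSwap E (tensorSwap E r) = r := by
  induction r with
  | zero => simp
  | tmul x y => simp
  | add x y hx hy => rw [map_add, map_add, hx, hy]

/-- The multiplication map `E ⊗ E → E`. -/
noncomputable abbrev tensorMul (E : Type*) [Field E] [Algebra ℚ E] : E ⊗[ℚ] E →ₐ[ℚ] E :=
  Algebra.TensorProduct.lmul' ℚ

theorem tensorMul_swap (r : E ⊗[ℚ] E) : tensorMul E (tensorSwap E r) = tensorMul E r := by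
  induction r with
  | zero => simp
  | tmul x y => simp [mul_comm]
  | add x y hx hy => rw [map_add, map_add, map_add, hx, hy]

theorem tensorMul_surjective : Function.Surjective (tensorMul E) := fun x => ⟨x ⊗ₜ 1, by simp⟩

/-- A quotient field `L` of `E ⊗ E` of degree `g (g - 1)`, where `g = [E : ℚ] ≥ 3`. It exists if
and only if the Galois group of the normal closure of `E` is doubly transitive on the embeddings
of `E`; then `E ⊗ E = E × L`. -/
structure IsPairField (ψ : E ⊗[ℚ] E →ₐ[ℚ] L) : Prop where
  surjective : Function.Surjective ψ
  finrank_eq : Module.finrank ℚ L = Module.finrank ℚ E * (Module.finrank ℚ E - 1)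
  three_le : 3 ≤ Module.finrank ℚ E

variable {ψ : E ⊗[ℚ] E →ₐ[ℚ] L}

theorem IsPairField.ker_ne (h : IsPairField ψ) :
    RingHom.ker (tensorMul E) ≠ RingHom.ker ψ := by
  intro hk
  have e1 := (Ideal.quotientKerAlgEquivOfSurjective (tensorMul_surjective (E := E)))
  have e2 := (Ideal.quotientKerAlgEquivOfSurjective h.surjective)
  have e3 := e1.symm.trans ((Ideal.quotientEquivAlgOfEq ℚ hk).trans e2)
  have := e3.toLinearEquiv.finrank_eq
  rw [h.finrank_eq] at this
  have h3 := h.three_le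
  have : Module.finrank ℚ E * 2 ≤ Module.finrank ℚ E * (Module.finrank ℚ E - 1) :=
    Nat.mul_le_mul_left _ (by omega)
  omega

theorem IsPairField.exists_separating (h : IsPairField ψ) :
    (∃ d, tensorMul E d = 0 ∧ ψ d = 1) ∧ (∃ e, ψ e = 0 ∧ tensorMul E e = 1) := by
  have hm1 := RingHom.ker_isMaximal_of_surjective (tensorMul E) (tensorMul_surjective (E := E))
  have hm2 := RingHom.ker_isMaximal_of_surjective ψ h.surjective
  have hsup := hm1.coprime_of_ne hm2 h.ker_ne
  obtain ⟨a, ha, b, hb, hab⟩ := Submodule.mem_sup.1 ((Ideal.eq_top_iff_one _).1 hsup)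
  rw [RingHom.mem_ker] at ha hb
  refine ⟨⟨a, ha, ?_⟩, ⟨b, hb, ?_⟩⟩
  · have := congrArg ψ hab
    rwa [map_add, hb, add_zero, map_one] at this
  · have := congrArg (tensorMul E) hab
    rwa [map_add, ha, zero_add, map_one] at this

variable [FiniteDimensional ℚ E]

theorem IsPairField.finite (h : IsPairField ψ) : FiniteDimensional ℚ L :=
  Module.Finite.of_surjective ψ.toLinearMap h.surjective

/-- The map `E ⊗ E → E × L` is surjective by the Chinese remainder theorem, and the dimensions
agree. -/
theorem IsPairField.eq_zero (h : IsPairField ψ) {r : E ⊗[ℚ] E} (h1 : tensorMul E r = 0)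
    (h2 : ψ r = 0) : r = 0 := by
  have := h.finite
  obtain ⟨⟨d, hd, hd'⟩, ⟨e, he, he'⟩⟩ := h.exists_separating
  let F : E ⊗[ℚ] E →ₗ[ℚ] E × L := (tensorMul E).toLinearMap.prod ψ.toLinearMap
  have hF : Function.Surjective F := by
    rintro ⟨x, y⟩
    obtain ⟨a, rfl⟩ := tensorMul_surjective x
    obtain ⟨b, rfl⟩ := h.surjective y
    refine ⟨a * e + b * d, ?_⟩
    ext <;> simp [F, hd, hd', he, he']
  have hdim : Module.finrank ℚ (E ⊗[ℚ] E) = Module.finrank ℚ (E × L) := by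
    rw [Module.finrank_tensorProduct, Module.finrank_prod, h.finrank_eq]
    obtain ⟨n, hn⟩ : ∃ n, Module.finrank ℚ E = n + 1 :=
      ⟨Module.finrank ℚ E - 1, by have := h.three_le; omega⟩
    rw [hn]; simp; ring
  have hinj := (LinearMap.injective_iff_surjective_of_finrank_eq_finrank hdim).2 hF
  apply hinj
  ext
  · simpa [F] using h1
  · simpa [F] using h2

theorem IsPairField.mul_eq_zero (h : IsPairField ψ) {r d : E ⊗[ℚ] E} (hr : ψ r = 0)
    (hd : tensorMul E d = 0) : r * d = 0 :=
  h.eq_zero (by rw [map_mul, hd, mul_zero]) (by rw [map_mul, hr, zero_mul])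

/-- The kernel of `E ⊗ E → L` consists of symmetric tensors. -/
theorem IsPairField.swap_eq (h : IsPairField ψ) {r : E ⊗[ℚ] E} (hr : ψ r = 0) :
    tensorSwap E r = r := by
  have hs : ψ (tensorSwap E r) = 0 := by
    obtain ⟨⟨d, hd, hd'⟩, -⟩ := h.exists_separating
    have h1 : r * tensorSwap E d = 0 := h.mul_eq_zero hr (by rw [tensorMul_swap, hd])
    have h2 : tensorSwap E r * d = 0 := by
      rw [← tensorSwap_swap d, ← map_mul, h1, map_zero]
    simpa [hd'] using congrArg ψ h2
  refine sub_eq_zero.1 (h.eq_zero ?_ ?_)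
  · rw [map_sub, tensorMul_swap, sub_self]
  · rw [map_sub, hs, hr, sub_zero]

/-- Any nonzero antisymmetric functional on `E ⊗ E` generates the others: they factor through the
field `L`, whose functionals are a one-dimensional vector space over `L`. -/
theorem IsPairField.exists_eq_mul (h : IsPairField ψ) {φ₁ φ₂ : Module.Dual ℚ (E ⊗[ℚ] E)}
    (h₁ : ∀ z, φ₁ (tensorSwap E z) = -φ₁ z) (h₂ : ∀ z, φ₂ (tensorSwap E z) = -φ₂ z)
    (hne : φ₁ ≠ 0) :
    ∃ r, ∀ z, φ₂ z = φ₁ (r * z) := by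
  have := h.finite
  have hker : ∀ φ : Module.Dual ℚ (E ⊗[ℚ] E), (∀ z, φ (tensorSwap E z) = -φ z) →
      ∀ z, ψ z = 0 → φ z = 0 := by
    intro φ hφ z hz
    have := hφ z
    rw [h.swap_eq hz] at this
    linarith
  -- multiplication by tensors turns `φ₁` into any functional that vanishes on the kernel of `ψ`
  let G : E ⊗[ℚ] E →ₗ[ℚ] Module.Dual ℚ (E ⊗[ℚ] E) :=
    { toFun := fun r => φ₁ ∘ₗ LinearMap.mulLeft ℚ r
      map_add' := fun a b => by ext; simp [add_mul]
      map_smul' := fun a b => by ext; simp }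
  have hG : ∀ r z, G r z = φ₁ (r * z) := fun r z => rfl
  have hGker : LinearMap.ker G = LinearMap.ker ψ.toLinearMap := by
    ext r
    rw [LinearMap.mem_ker, LinearMap.mem_ker]
    constructor
    · intro hr
      by_contra hψ
      change ψ r ≠ 0 at hψ
      apply hne
      ext1
      refine LinearMap.ext fun x => ?_
      refine LinearMap.ext fun y => ?_
      obtain ⟨u, hu⟩ := h.surjective ((ψ r)⁻¹)
      have h0 : ψ (x ⊗ₜ[ℚ] y - r * (u * x ⊗ₜ[ℚ] y)) = 0 := by
        rw [map_sub, map_mul, map_mul, hu, mul_inv_cancel_left₀ hψ, sub_self]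
      have h3 := hker φ₁ h₁ _ h0
      rw [map_sub, ← hG, hr, LinearMap.zero_apply, sub_zero] at h3
      simpa using h3
    · intro hr
      ext1
      refine LinearMap.ext fun x => LinearMap.ext fun y => ?_
      change ψ r = 0 at hr
      exact hker φ₁ h₁ (r * x ⊗ₜ[ℚ] y) (by rw [map_mul, hr, zero_mul])
  have hle : LinearMap.range G ≤ (LinearMap.ker ψ.toLinearMap).dualAnnihilator := by
    rintro _ ⟨r, rfl⟩
    rw [Submodule.mem_dualAnnihilator]
    intro z hz
    change ψ z = 0 at hz
    exact hker φ₁ h₁ (r * z) (by rw [map_mul, hz, mul_zero])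
  have heq : LinearMap.range G = (LinearMap.ker ψ.toLinearMap).dualAnnihilator := by
    refine Submodule.eq_of_le_of_finrank_eq hle ?_
    have e1 := LinearMap.finrank_range_add_finrank_ker G
    have e2 := Subspace.finrank_add_finrank_dualAnnihilator_eq (LinearMap.ker ψ.toLinearMap)
    rw [hGker] at e1
    omega
  have hmem : φ₂ ∈ LinearMap.range G := by
    rw [heq, Submodule.mem_dualAnnihilator]
    exact fun z hz => hker φ₂ h₂ z hz
  obtain ⟨r, hr⟩ := hmem
  have hr' : ∀ z, φ₂ z = φ₁ (r * z) := fun z => by rw [← hG, hr]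
  exact ⟨r, hr'⟩

/-- A root of unity `ζ` in `E` is rational: its two images in `L` generate the same cyclic group,
so a tensor `1 ⊗ ζ - η ⊗ 1` lies in the kernel of `E ⊗ E → L`. This kernel is annihilated by all
`x ⊗ 1 - 1 ⊗ x`, and a functional on the first factor that vanishes at `1` and `η` then gives a
rational multiple of `ζ` that is rational. -/
theorem IsPairField.mem_range_of_pow_eq_one (h : IsPairField ψ) {ζ : E} {n : ℕ} (hn : 0 < n)
    (hζ : ζ ^ n = 1) : ∃ q : ℚ, algebraMap ℚ E q = ζ := by
  have hfin : IsOfFinOrder ζ := isOfFinOrder_iff_pow_eq_one.2 ⟨n, hn, hζ⟩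
  have hpos := hfin.orderOf_pos
  have hprim : IsPrimitiveRoot ζ (orderOf ζ) := IsPrimitiveRoot.orderOf ζ
  let i : E →ₐ[ℚ] L := ψ.comp Algebra.TensorProduct.includeLeft
  let j : E →ₐ[ℚ] L := ψ.comp Algebra.TensorProduct.includeRight
  have hi : IsPrimitiveRoot (i ζ) (orderOf ζ) := hprim.map_of_injective i.toRingHom.injective
  have : NeZero (orderOf ζ) := ⟨hpos.ne'⟩
  obtain ⟨m, -, hm⟩ := hi.eq_pow_of_pow_eq_one (ξ := j ζ)
    (by rw [← map_pow, pow_orderOf_eq_one, map_one])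
  obtain ⟨η, hη⟩ : ∃ η : E, ψ (η ⊗ₜ 1) = ψ (1 ⊗ₜ ζ) := ⟨ζ ^ m, by
    have : i (ζ ^ m) = j ζ := by rw [map_pow, hm]
    simpa [i, j] using this⟩
  have hker : ψ (1 ⊗ₜ ζ - η ⊗ₜ 1) = 0 := by rw [map_sub, hη, sub_self]
  have key : ∀ x : E, x ⊗ₜ[ℚ] ζ - (x * η) ⊗ₜ[ℚ] (1 : E) - 1 ⊗ₜ[ℚ] (x * ζ) + η ⊗ₜ[ℚ] x = 0 := by
    intro x
    have h1 := h.mul_eq_zero (d := x ⊗ₜ[ℚ] (1 : E) - (1 : E) ⊗ₜ[ℚ] x) hker (by simp)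
    rw [← h1]
    simp [mul_sub, sub_mul, mul_comm]
    abel
  -- a functional that kills `1` and `η`
  obtain ⟨l, hl0, hl⟩ : ∃ l : Module.Dual ℚ E, l ≠ 0 ∧
      Submodule.span ℚ {1, η} ≤ LinearMap.ker l := by
    apply Submodule.exists_le_ker_of_lt_top
    rw [lt_top_iff_ne_top]
    intro htop
    have h3 := h.three_le
    have h4 : Module.finrank ℚ (Submodule.span ℚ ({1, η} : Set E)) ≤ 2 := by
      classical
      have := finrank_span_finset_le_card (R := ℚ) ({1, η} : Finset E)
      rw [Finset.coe_pair] at this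
      exact this.trans Finset.card_le_two
    rw [htop, finrank_top] at h4
    omega
  have hl1 : l 1 = 0 := hl (Submodule.subset_span (by simp))
  have hlη : l η = 0 := hl (Submodule.subset_span (by simp))
  obtain ⟨x, hx⟩ : ∃ x, l x ≠ 0 := by
    by_contra hcon
    push Not at hcon
    exact hl0 (LinearMap.ext hcon)
  have h7 := congrArg (fun z => TensorProduct.lid ℚ E (l.rTensor E z)) (key x)
  simp only [map_sub, map_add, map_zero, LinearMap.rTensor_tmul, TensorProduct.lid_tmul, hl1, hlη,
    zero_smul, sub_zero, add_zero] at h7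
  refine ⟨l (x * η) / l x, ?_⟩
  have h8 : l x • ζ = l (x * η) • (1 : E) := sub_eq_zero.1 h7
  rw [Algebra.smul_def, Algebra.smul_def, mul_one] at h8
  rw [map_div₀, ← h8, mul_div_cancel_left₀]
  rw [ne_eq, map_eq_zero]
  exact hx

end TensorSquare

/-! ### Polynomials with prescribed reductions and number of real roots -/

section Polynomials

open Polynomial

theorem exists_monic_irreducible_natDegree (p : ℕ) [Fact p.Prime] {n : ℕ} (hn : n ≠ 0) :
    ∃ h : (ZMod p)[X], h.Monic ∧ Irreducible h ∧ h.natDegree = n := by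
  obtain ⟨α, hα⟩ := Field.exists_primitive_element (ZMod p) (GaloisField p n)
  have hint : IsIntegral (ZMod p) α := IsIntegral.of_finite _ α
  refine ⟨minpoly (ZMod p) α, minpoly.monic hint, minpoly.irreducible hint, ?_⟩
  rw [(Field.primitive_element_iff_minpoly_natDegree_eq _ α).1 hα, GaloisField.finrank p hn]

theorem exists_monic_lift {R : Type*} [CommRing R] [Nontrivial R]
    (φ : ℤ →+* R) (hφ : Function.Surjective φ) {h : R[X]} (hm : h.Monic) :
    ∃ A : ℤ[X], A.Monic ∧ A.natDegree = h.natDegree ∧ A.map φ = h := by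
  have hl : h ∈ lifts φ := by
    rw [mem_lifts]
    exact map_surjective φ hφ h
  obtain ⟨A, hA, hdeg, hmon⟩ := lifts_and_natDegree_eq_and_monic hl hm
  exact ⟨A, hmon, hdeg, hA⟩

/-- The polynomials with integer coefficients of degree `g` with prescribed reductions modulo `2`
and modulo `3`: irreducible, and the product of `X` and an irreducible polynomial. -/
theorem exists_polynomial_mod_two_mod_three {g : ℕ} (hg : 3 ≤ g) :
    ∃ Q : ℤ[X], Q.Monic ∧ Q.natDegree = g ∧ Irreducible (Q.map (Int.castRingHom (ZMod 2))) ∧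
      ∃ h : (ZMod 3)[X], Irreducible h ∧ h.natDegree = g - 1 ∧
        Q.map (Int.castRingHom (ZMod 3)) = X * h := by
  obtain ⟨h₂, hm₂, hi₂, hd₂⟩ := exists_monic_irreducible_natDegree 2 (n := g) (by omega)
  obtain ⟨h₃, hm₃, hi₃, hd₃⟩ := exists_monic_irreducible_natDegree 3 (n := g - 1) (by omega)
  obtain ⟨A, hmA, hdA, hA⟩ := exists_monic_lift (Int.castRingHom (ZMod 2))
    (ZMod.ringHom_surjective _) hm₂
  obtain ⟨B, hmB, hdB, hB⟩ := exists_monic_lift (Int.castRingHom (ZMod 3))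
    (ZMod.ringHom_surjective _) (monic_X.mul hm₃)
  rw [hd₂] at hdA
  rw [natDegree_X_mul hm₃.ne_zero, hd₃, Nat.sub_add_cancel (by omega)] at hdB
  -- the polynomial `A + 2 (A - B)` is congruent to `A` modulo `2` and to `B` modulo `3`
  have hlt : (2 * (A - B)).degree < A.degree := by
    have h1 : (A - B).degree < A.degree := degree_sub_lt_left
      (by rw [degree_eq_natDegree hmA.ne_zero, degree_eq_natDegree hmB.ne_zero, hdA, hdB])
      hmA.ne_zero (by rw [hmA.leadingCoeff, hmB.leadingCoeff])
    have : (2 : ℤ[X]) = C 2 := rfl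
    rwa [this, degree_C_mul two_ne_zero]
  have h2 : (2 : (ZMod 2)[X]) = 0 := CharTwo.two_eq_zero
  have h3 : (3 : (ZMod 3)[X]) = 0 := by
    have := CharP.cast_eq_zero (ZMod 3)[X] 3
    exact_mod_cast this
  refine ⟨A + 2 * (A - B), hmA.add_of_left hlt, ?_, ?_, h₃, hi₃, hd₃, ?_⟩
  · rw [natDegree_add_eq_left_of_degree_lt hlt, hdA]
  · rw [Polynomial.map_add, Polynomial.map_mul, Polynomial.map_ofNat, h2, zero_mul, add_zero, hA]
    exact hi₂
  · rw [← hB, Polynomial.map_add, Polynomial.map_mul, Polynomial.map_ofNat, Polynomial.map_sub]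
    linear_combination (A.map (Int.castRingHom (ZMod 3)) -
      B.map (Int.castRingHom (ZMod 3))) * h3

/-- A monic polynomial that is small at `x` has a root near `x`. -/
theorem exists_root_near {F : ℂ[X]} (hF : F.Monic) {x : ℂ} {δ : ℝ} (hδ : 0 < δ)
    (h : ‖F.eval x‖ < δ ^ F.natDegree) : ∃ z, F.eval z = 0 ∧ ‖z - x‖ < δ := by
  by_contra! hcon
  refine absurd h (not_lt.2 ?_)
  have hs := IsAlgClosed.splits F
  rw [hs.eval_eq_prod_roots_of_monic hF, hs.natDegree_eq_card_roots]
  have hpos : ∀ z ∈ F.roots, δ ≤ ‖x - z‖ := fun z hz => by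
    rw [norm_sub_rev]
    exact hcon z (isRoot_of_mem_roots hz)
  clear h
  generalize F.roots = m at hpos
  induction m using Multiset.induction with
  | empty => simp
  | cons a m ih =>
    rw [Multiset.map_cons, Multiset.prod_cons, norm_mul, Multiset.card_cons, pow_succ, mul_comm]
    gcongr
    · exact hpos a (Multiset.mem_cons_self a m)
    · exact ih fun z hz => hpos z (Multiset.mem_cons_of_mem hz)

/-- If the roots of a real polynomial are close to points `x i`, each of which is either real or
far from the real axis, and which are far from each other, then the number of real roots is the
number of real points among the `x i`. -/
theorem ncard_real_roots {ι : Type*} [Fintype ι] {F : ℤ[X]} (hF : F.Monic)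
    (hdeg : F.natDegree = Fintype.card ι) {x z : ι → ℂ} {δ : ℝ}
    (hsep : ∀ i j, i ≠ j → 2 * δ ≤ ‖x i - x j‖) (him : ∀ i, (x i).im = 0 ∨ δ ≤ |(x i).im|)
    (hz : ∀ i, aeval (z i) F = 0) (hzx : ∀ i, ‖z i - x i‖ < δ) :
    {w : ℂ | aeval w F = 0 ∧ w.im = 0}.ncard = Fintype.card {i // (x i).im = 0} := by
  classical
  have hinj : Function.Injective z := by
    intro i j hij
    by_contra hne
    have h1 := hsep i j hne
    have h2 : ‖x i - x j‖ ≤ ‖z i - x i‖ + ‖z j - x j‖ := by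
      rw [← hij, norm_sub_rev (z i) (x i), ← sub_add_sub_cancel (x i) (z i) (x j)]
      exact norm_add_le _ _
    linarith [hzx i, hzx j]
  have hF' : (F.map (algebraMap ℤ ℂ)).Monic := hF.map _
  have hroots : ∀ w, aeval w F = 0 → ∃ i, z i = w := by
    have hsub : Finset.univ.image z ⊆ (F.map (algebraMap ℤ ℂ)).roots.toFinset := by
      intro w hw
      obtain ⟨i, -, rfl⟩ := Finset.mem_image.1 hw
      rw [Multiset.mem_toFinset, mem_roots hF'.ne_zero, IsRoot.def, eval_map_algebraMap, hz i]
    have heq := Finset.eq_of_subset_of_card_le hsub (by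
      rw [Finset.card_image_of_injective _ hinj, Finset.card_univ, ← hdeg,
        ← hF.natDegree_map (algebraMap ℤ ℂ)]
      exact (Multiset.toFinset_card_le _).trans (card_roots' _))
    intro w hw
    have : w ∈ (F.map (algebraMap ℤ ℂ)).roots.toFinset := by
      rw [Multiset.mem_toFinset, mem_roots hF'.ne_zero, IsRoot.def, eval_map_algebraMap, hw]
    rw [← heq, Finset.mem_image] at this
    obtain ⟨i, -, hi⟩ := this
    exact ⟨i, hi⟩
  have hconj : ∀ w, aeval w F = 0 → aeval (starRingEnd ℂ w) F = 0 := by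
    intro w hw
    have := congrArg (starRingEnd ℂ) hw
    rw [map_zero, aeval_def, hom_eval₂] at this
    rw [aeval_def, ← this]
    congr 1
    exact RingHom.ext_int _ _
  have hreal : ∀ i, (z i).im = 0 ↔ (x i).im = 0 := by
    intro i
    constructor
    · intro h0
      refine (him i).resolve_right fun hle => ?_
      have h1 := Complex.abs_im_le_norm (z i - x i)
      rw [Complex.sub_im, h0, zero_sub, abs_neg] at h1
      linarith [hzx i]
    · intro h0
      obtain ⟨j, hj⟩ := hroots _ (hconj _ (hz i))
      have h1 : ‖z j - x i‖ < δ := by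
        rw [hj]
        have : starRingEnd ℂ (z i) - x i = starRingEnd ℂ (z i - x i) := by
          rw [map_sub, Complex.conj_eq_iff_im.2 h0]
        rw [this, RCLike.norm_conj]
        exact hzx i
      have hji : j = i := by
        by_contra hne
        have h2 := hsep j i hne
        have h3 : ‖x j - x i‖ ≤ ‖z j - x j‖ + ‖z j - x i‖ := by
          rw [norm_sub_rev (z j) (x j), ← sub_add_sub_cancel (x j) (z j) (x i)]
          exact norm_add_le _ _
        linarith [hzx j]
      rw [hji] at hj
      exact Complex.conj_eq_iff_im.1 hj.symm
  have hset : {w : ℂ | aeval w F = 0 ∧ w.im = 0} = z '' {i | (x i).im = 0} := by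
    ext w
    constructor
    · rintro ⟨hw, hw'⟩
      obtain ⟨i, rfl⟩ := hroots w hw
      exact ⟨i, (hreal i).1 hw', rfl⟩
    · rintro ⟨i, hi, rfl⟩
      exact ⟨hz i, (hreal i).2 hi⟩
  rw [hset, Set.ncard_image_of_injective _ hinj, ← Nat.card_coe_set_eq, ← Nat.card_eq_fintype_card]
  rfl

/-- A polynomial of degree less than `g` grows more slowly than the `g`-th power. -/
theorem eventually_norm_aeval_lt (q : ℤ[X]) {g : ℕ} (hq : q.natDegree < g) (x : ℂ) {c : ℝ}
    (hc : 0 < c) : ∀ᶠ N : ℕ in Filter.atTop, ‖aeval ((N : ℂ) * x) q‖ < (c * N) ^ g := by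
  have key : Filter.Tendsto (fun N : ℕ => ∑ i ∈ Finset.range g,
      ‖(q.coeff i : ℂ) * x ^ i‖ * ((N : ℝ)⁻¹) ^ (g - i)) Filter.atTop (nhds 0) := by
    rw [← Finset.sum_const_zero (s := Finset.range g) (ι := ℕ)]
    refine tendsto_finsetSum _ fun i hi => ?_
    rw [Finset.mem_range] at hi
    have h1 := (tendsto_natCast_atTop_atTop (R := ℝ)).inv_tendsto_atTop.pow (g - i)
    rw [zero_pow (by omega)] at h1
    simpa using h1.const_mul ‖(q.coeff i : ℂ) * x ^ i‖
  filter_upwards [key.eventually_lt_const (pow_pos hc g), Filter.eventually_gt_atTop 0]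
    with N hN hN0
  have hN0' : (0 : ℝ) < N := by exact_mod_cast hN0
  have h2 : ‖aeval ((N : ℂ) * x) q‖ ≤ ∑ i ∈ Finset.range g, ‖(q.coeff i : ℂ) * x ^ i‖ * N ^ i := by
    rw [aeval_eq_sum_range' hq]
    refine (norm_sum_le _ _).trans (Finset.sum_le_sum fun i _ => le_of_eq ?_)
    rw [zsmul_eq_mul, mul_pow, mul_comm ((N : ℂ) ^ i), ← mul_assoc, norm_mul _ ((N : ℂ) ^ i),
      norm_pow (N : ℂ), Complex.norm_natCast]
  refine h2.trans_lt ?_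
  rw [mul_pow]
  calc _ = (∑ i ∈ Finset.range g, ‖(q.coeff i : ℂ) * x ^ i‖ * ((N : ℝ)⁻¹) ^ (g - i)) * N ^ g := by
        rw [Finset.sum_mul]
        refine Finset.sum_congr rfl fun i hi => ?_
        rw [Finset.mem_range] at hi
        have : (N : ℝ) ^ g = N ^ (g - i) * N ^ i := by rw [← pow_add]; congr 1; omega
        rw [this, inv_pow]
        field_simp
    _ < _ := by gcongr

/-- The coordinates of the points `0, …, r - 1` and `± (j + 1) i`, `j < s`, of the complex plane. -/
def modelPoint (r s : ℕ) : Fin r ⊕ Fin s × Bool → ℤ × ℤ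
  | .inl k => ((k : ℕ), 0)
  | .inr (j, true) => (0, (j : ℕ) + 1)
  | .inr (j, false) => (0, -((j : ℕ) + 1))

theorem modelPoint_injective (r s : ℕ) : Function.Injective (modelPoint r s) := by
  rintro (k | ⟨j, _ | _⟩) (k' | ⟨j', _ | _⟩) h <;>
    simp only [modelPoint, Prod.mk.injEq, Sum.inl.injEq, Sum.inr.injEq, Fin.ext_iff, reduceCtorEq,
      and_true, and_false] at h ⊢ <;> omega

theorem modelPoint_snd_eq_zero_iff (r s : ℕ) (i) : (modelPoint r s i).2 = 0 ↔ i.isLeft = true := by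
  rcases i with k | ⟨j, _ | _⟩ <;> simp only [modelPoint, Sum.isLeft_inl, Sum.isLeft_inr] <;>
    simp <;> omega

/-- The points `0, …, r - 1` and `± (j + 1) i`, `j < s`, of the complex plane. -/
noncomputable def modelRoot (r s : ℕ) (i : Fin r ⊕ Fin s × Bool) : ℂ :=
  ⟨(modelPoint r s i).1, (modelPoint r s i).2⟩

theorem modelRoot_im (r s : ℕ) (i) : (modelRoot r s i).im = (modelPoint r s i).2 := rfl

/-- Distinct Gaussian integers have distance at least `1`. -/
theorem modelRoot_sep (r s : ℕ) (i j) (hij : i ≠ j) :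
    1 ≤ ‖modelRoot r s i - modelRoot r s j‖ := by
  have hint : ∀ a b : ℤ, a ≠ b → (1 : ℝ) ≤ |(a : ℝ) - b| := fun a b hab => by
    exact_mod_cast Int.one_le_abs (sub_ne_zero.2 hab)
  by_cases h1 : (modelPoint r s i).1 = (modelPoint r s j).1
  · have h2 : (modelPoint r s i).2 ≠ (modelPoint r s j).2 := fun h2 =>
      hij (modelPoint_injective r s (Prod.ext h1 h2))
    exact (hint _ _ h2).trans (Complex.abs_im_le_norm (modelRoot r s i - modelRoot r s j))
  · exact (hint _ _ h1).trans (Complex.abs_re_le_norm (modelRoot r s i - modelRoot r s j))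

/-- The monic polynomial with the roots `modelRoot`. -/
noncomputable def modelPoly (r s : ℕ) : ℤ[X] :=
  (∏ k : Fin r, (X - C ((k : ℕ) : ℤ))) * ∏ j : Fin s, (X ^ 2 + C (((j : ℕ) + 1 : ℤ) ^ 2))

theorem modelPoly_monic (r s : ℕ) : (modelPoly r s).Monic :=
  (monic_prod_of_monic _ _ fun _ _ => monic_X_sub_C _).mul
    (monic_prod_of_monic _ _ fun _ _ => monic_X_pow_add_C _ two_ne_zero)

theorem modelPoly_natDegree (r s : ℕ) : (modelPoly r s).natDegree = r + 2 * s := by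
  rw [modelPoly, Monic.natDegree_mul (monic_prod_of_monic _ _ fun _ _ => monic_X_sub_C _)
    (monic_prod_of_monic _ _ fun _ _ => monic_X_pow_add_C _ two_ne_zero),
    natDegree_prod_of_monic _ _ fun _ _ => monic_X_sub_C _,
    natDegree_prod_of_monic _ _ fun _ _ => monic_X_pow_add_C _ two_ne_zero]
  simp only [natDegree_X_sub_C, natDegree_X_pow_add_C]
  simp [mul_comm]

theorem modelPoly_aeval (r s : ℕ) (i) : aeval (modelRoot r s i) (modelPoly r s) = 0 := by
  rw [modelPoly, map_mul, map_prod, map_prod]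
  rcases i with k | ⟨j, b⟩
  · rw [Finset.prod_eq_zero (Finset.mem_univ k), zero_mul]
    have h0 : modelRoot r s (.inl k) = (k : ℕ) := by
      apply Complex.ext <;> simp [modelRoot, modelPoint]
    simp [h0]
  · rw [mul_eq_zero_of_right]
    rw [Finset.prod_eq_zero (Finset.mem_univ j)]
    have hsq : modelRoot r s (.inr (j, b)) ^ 2 = -((j : ℕ) + 1) ^ 2 := by
      cases b <;> apply Complex.ext <;> simp [modelRoot, modelPoint, sq]
      ring
    simp [hsq]

/-- The polynomials that generate the number fields of the theorem. They are of the form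
`N ^ g P (X / N) + (Q - X ^ g)`, where `P` is the model polynomial, `Q` has the prescribed
reductions modulo `2` and modulo `3`, and `N` is a large multiple of `6`. -/
theorem exists_polynomial {g r s : ℕ} (hg : 3 ≤ g) (hrs : r + 2 * s = g) :
    ∃ F : ℤ[X], F.Monic ∧ F.natDegree = g ∧ Irreducible (F.map (Int.castRingHom (ZMod 2))) ∧
      (∃ h : (ZMod 3)[X], Irreducible h ∧ h.natDegree = g - 1 ∧
        F.map (Int.castRingHom (ZMod 3)) = X * h) ∧
      {w : ℂ | aeval w F = 0 ∧ w.im = 0}.ncard = r := by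
  obtain ⟨Q, hQm, hQd, hQ2, h, hh, hhd, hQ3⟩ := exists_polynomial_mod_two_mod_three hg
  set P := modelPoly r s
  have hPm : P.Monic := modelPoly_monic r s
  have hPd : P.natDegree = g := (modelPoly_natDegree r s).trans hrs
  have hq : (Q - X ^ g).degree < (g : WithBot ℕ) := by
    have := degree_sub_lt_left (p := Q) (q := X ^ g)
      (by rw [degree_eq_natDegree hQm.ne_zero, hQd, degree_X_pow]) hQm.ne_zero
      (by rw [hQm.leadingCoeff, (monic_X_pow g).leadingCoeff])
    rwa [degree_eq_natDegree hQm.ne_zero, hQd] at this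
  have hq' : (Q - X ^ g).natDegree < g := by
    by_cases h0 : Q - X ^ g = 0
    · rw [h0, natDegree_zero]; omega
    · exact (natDegree_lt_iff_degree_lt h0).2 hq
  obtain ⟨M, hM, hMpos⟩ : ∃ M : ℕ, (∀ i, ‖aeval (((6 * M : ℕ) : ℂ) * modelRoot r s i) (Q - X ^ g)‖
      < (1 / 2 * (6 * M : ℕ)) ^ g) ∧ 0 < M := by
    have h1 := (Filter.eventually_all.2 fun i =>
      eventually_norm_aeval_lt (Q - X ^ g) hq' (modelRoot r s i) (c := 1 / 2) (by norm_num))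
    have h2 : Filter.Tendsto (fun M : ℕ => 6 * M) Filter.atTop Filter.atTop :=
      Filter.tendsto_id.const_mul_atTop' (by norm_num)
    exact ((h2.eventually h1).and (Filter.eventually_gt_atTop 0)).exists
  set N := 6 * M
  have hNpos : (0 : ℝ) < N := by positivity
  set F := P.scaleRoots (N : ℤ) + (Q - X ^ g)
  have hSm : (P.scaleRoots (N : ℤ)).Monic := (monic_scaleRoots_iff _).2 hPm
  have hSd : (P.scaleRoots (N : ℤ)).natDegree = g := by rw [natDegree_scaleRoots, hPd]
  have hlt : (Q - X ^ g).degree < (P.scaleRoots (N : ℤ)).degree := by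
    rwa [degree_eq_natDegree hSm.ne_zero, hSd]
  have hFm : F.Monic := hSm.add_of_left hlt
  have hFd : F.natDegree = g := by rw [natDegree_add_eq_left_of_degree_lt hlt, hSd]
  -- modulo a divisor of `N`, the scaled model polynomial is `X ^ g`
  have hred : ∀ n : ℕ, 1 < n → n ∣ 6 → F.map (Int.castRingHom (ZMod n)) =
      Q.map (Int.castRingHom (ZMod n)) := by
    intro n hn hdvd
    have : Fact (1 < n) := ⟨hn⟩
    have hN0 : ((N : ℤ) : ZMod n) = 0 := by
      rw [Int.cast_natCast, ZMod.natCast_eq_zero_iff]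
      exact hdvd.trans (Dvd.intro _ rfl)
    have : (P.scaleRoots (N : ℤ)).map (Int.castRingHom (ZMod n)) = X ^ g := by
      rw [map_scaleRoots _ _ _ (by rw [hPm.leadingCoeff]; simp), eq_intCast, hN0, scaleRoots_zero,
        (hPm.map _).leadingCoeff, one_smul, hPm.natDegree_map, hPd]
    rw [Polynomial.map_add, this, Polynomial.map_sub, Polynomial.map_pow, map_X]
    ring
  refine ⟨F, hFm, hFd, ?_, ⟨h, hh, hhd, ?_⟩, ?_⟩
  · rw [hred 2 (by norm_num) (by norm_num)]; exact hQ2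
  · rw [hred 3 (by norm_num) (by norm_num)]; exact hQ3
  · have hz : ∀ i, ∃ z, (F.map (algebraMap ℤ ℂ)).eval z = 0 ∧
        ‖z - N * modelRoot r s i‖ < 1 / 2 * N := by
      intro i
      refine exists_root_near (hFm.map _) (by positivity) ?_
      rw [hFm.natDegree_map, hFd, eval_map_algebraMap, map_add]
      have h0 := scaleRoots_aeval_eq_zero (r := (N : ℤ)) (modelPoly_aeval r s i)
      simp only [algebraMap_int_eq, eq_intCast, Int.cast_natCast] at h0
      rw [h0, zero_add]
      exact hM i
    choose z hz hzx using hz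
    have hcard : F.natDegree = Fintype.card (Fin r ⊕ Fin s × Bool) := by
      rw [hFd, ← hrs]; simp [mul_comm]
    rw [ncard_real_roots hFm hcard (x := fun i => N * modelRoot r s i) (z := z) (δ := 1 / 2 * N)
      ?_ ?_ ?_ hzx]
    · have him : ∀ i, ((N : ℂ) * modelRoot r s i).im = 0 ↔ i.isLeft = true := fun i => by
        rw [← modelPoint_snd_eq_zero_iff, ← Complex.ofReal_natCast, Complex.im_ofReal_mul,
          modelRoot_im, mul_eq_zero_iff_left hNpos.ne', Int.cast_eq_zero]
      have e : Fin r ≃ {i // ((N : ℂ) * modelRoot r s i).im = 0} :=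
        Equiv.ofBijective (fun k => ⟨.inl k, (him _).2 rfl⟩)
          ⟨fun k k' hk => Sum.inl_injective (congrArg Subtype.val hk), fun ⟨i, hi⟩ => by
            obtain ⟨k, rfl⟩ := Sum.isLeft_iff.1 ((him i).1 hi)
            exact ⟨k, rfl⟩⟩
      rw [← Fintype.card_congr e, Fintype.card_fin]
    · intro i j hij
      rw [← mul_sub, norm_mul, Complex.norm_natCast]
      nlinarith [modelRoot_sep r s i j hij]
    · intro i
      rw [← Complex.ofReal_natCast, Complex.im_ofReal_mul, abs_mul, abs_of_pos hNpos, modelRoot_im]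
      by_cases h0 : (modelPoint r s i).2 = 0
      · left; rw [h0, Int.cast_zero, mul_zero]
      · have : (1 : ℝ) ≤ |((modelPoint r s i).2 : ℝ)| := by exact_mod_cast Int.one_le_abs h0
        right; nlinarith
    · intro i
      rw [← eval_map_algebraMap]
      exact hz i

end Polynomials

/-! ### Number fields with a doubly transitive Galois group -/

section NumberFields

open Polynomial NumberField

/-- If the minimal polynomial of a generator `α` of `E` is over `E` the product of `X - α` and
an irreducible polynomial `k`, then `E[X] / k` is a quotient field of `E ⊗ E`. -/
theorem exists_isPairField {E : Type} [Field E] [Algebra ℚ E]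
    (pb : PowerBasis ℚ E) {k : E[X]} (hk : Irreducible k)
    (hfac : (minpoly ℚ pb.gen).map (algebraMap ℚ E) = (X - C pb.gen) * k)
    (hdim : 3 ≤ Module.finrank ℚ E) :
    ∃ (L : Type) (_ : Field L) (_ : Algebra ℚ L) (ψ : E ⊗[ℚ] E →ₐ[ℚ] L), IsPairField ψ := by
  have : Fact (Irreducible k) := ⟨hk⟩
  have hint : IsIntegral ℚ pb.gen := pb.isIntegral_gen
  have hroot : aeval (AdjoinRoot.root k) (minpoly ℚ pb.gen) = 0 := by
    have h1 : aeval (AdjoinRoot.root k) ((minpoly ℚ pb.gen).map (algebraMap ℚ E)) = 0 := by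
      rw [hfac, map_mul, AdjoinRoot.aeval_eq, AdjoinRoot.aeval_eq, AdjoinRoot.mk_self, mul_zero]
    rwa [aeval_map_algebraMap] at h1
  let j : E →ₐ[ℚ] AdjoinRoot k := pb.lift (AdjoinRoot.root k) hroot
  let i : E →ₐ[ℚ] AdjoinRoot k := IsScalarTower.toAlgHom ℚ E (AdjoinRoot k)
  refine ⟨AdjoinRoot k, inferInstance, inferInstance, Algebra.TensorProduct.productMap i j,
    ?_, ?_, hdim⟩
  · intro y
    obtain ⟨p, rfl⟩ := AdjoinRoot.mk_surjective y
    induction p using Polynomial.induction_on with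
    | C a => exact ⟨a ⊗ₜ 1, by simp [i]⟩
    | add p q hp hq =>
      obtain ⟨a, ha⟩ := hp
      obtain ⟨b, hb⟩ := hq
      exact ⟨a + b, by rw [map_add, ha, hb, map_add]⟩
    | monomial n a _ =>
      refine ⟨a ⊗ₜ (pb.gen ^ (n + 1)), ?_⟩
      rw [Algebra.TensorProduct.productMap_apply_tmul, map_pow, pb.lift_gen, map_mul, map_pow,
        AdjoinRoot.mk_X]
      rfl
  · have h1 : Module.finrank E (AdjoinRoot k) = k.natDegree := by
      rw [(AdjoinRoot.powerBasis hk.ne_zero).finrank, AdjoinRoot.powerBasis_dim]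
    have h2 : Module.finrank ℚ E = 1 + k.natDegree := by
      rw [pb.finrank, ← pb.natDegree_minpoly, ← (minpoly.monic hint).natDegree_map (algebraMap ℚ E),
        hfac, natDegree_mul (X_sub_C_ne_zero _) hk.ne_zero, natDegree_X_sub_C]
    have := pb.finite
    rw [← Module.finrank_mul_finrank ℚ E (AdjoinRoot k), h1, h2, Nat.add_sub_cancel_left]

/-- The factor `X` modulo `3` of the polynomial lifts to a root in `ℚ₃`, and the cofactor remains
irreducible over `ℚ₃`; hence it is irreducible over `E`, which embeds into `ℚ₃`. -/
theorem exists_factor_irreducible {E : Type} [Field E] [Algebra ℚ E] (pb : PowerBasis ℚ E)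
    {F : ℤ[X]} (hF : F.Monic) (hmin : minpoly ℚ pb.gen = F.map (algebraMap ℤ ℚ))
    {h : (ZMod 3)[X]} (hh : Irreducible h) (hh1 : 2 ≤ h.natDegree)
    (hFh : F.map (Int.castRingHom (ZMod 3)) = X * h) :
    ∃ k : E[X], Irreducible k ∧
      (minpoly ℚ pb.gen).map (algebraMap ℚ E) = (X - C pb.gen) * k := by
  have : Fact (Nat.Prime 3) := ⟨Nat.prime_three⟩
  -- a root of `F` in `ℤ₃` that reduces to `0`
  have hcomp : (PadicInt.toZMod (p := 3)).comp (algebraMap ℤ ℤ_[3]) = Int.castRingHom (ZMod 3) :=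
    RingHom.ext_int _ _
  have hred : ∀ P : ℤ[X], PadicInt.toZMod (p := 3) (aeval (0 : ℤ_[3]) P) =
      (P.map (Int.castRingHom (ZMod 3))).eval 0 := by
    intro P
    rw [aeval_def, hom_eval₂, hcomp, map_zero, eval_map]
  have hnorm : ∀ x : ℤ_[3], PadicInt.toZMod x = 0 ↔ ‖x‖ < 1 := by
    intro x
    rw [← RingHom.mem_ker, PadicInt.ker_toZMod, IsLocalRing.mem_maximalIdeal, PadicInt.mem_nonunits]
  have h0 : ‖aeval (0 : ℤ_[3]) F‖ < 1 := by
    rw [← hnorm, hred, hFh]; simp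
  have h1 : ‖aeval (0 : ℤ_[3]) (derivative F)‖ = 1 := by
    refine le_antisymm (PadicInt.norm_le_one _) (not_lt.1 fun hlt => ?_)
    rw [← hnorm, hred, ← derivative_map, hFh] at hlt
    simp only [derivative_mul, derivative_X, one_mul, eval_add, eval_mul, eval_X, zero_mul,
      add_zero] at hlt
    have h2 := natDegree_eq_of_degree_eq_some (n := 1) (degree_eq_one_of_irreducible_of_root hh hlt)
    omega
  obtain ⟨a, ha, ha', -, -⟩ := hensels_lemma (p := 3) (F := F) (a := 0) (by rw [h1]; simpa using h0)
  rw [h1, sub_zero, ← hnorm] at ha'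
  -- the cofactor of `X - a` is irreducible over `ℤ₃` and `ℚ₃`
  obtain ⟨k₀, hk₀⟩ : (X - C a) ∣ F.map (algebraMap ℤ ℤ_[3]) := by
    rw [dvd_iff_isRoot, IsRoot.def, eval_map_algebraMap, ha]
  have hk₀m : k₀.Monic := (monic_X_sub_C a).of_mul_monic_left (hk₀ ▸ hF.map _)
  have hk₀h : k₀.map (PadicInt.toZMod (p := 3)) = h := by
    have h3 := congrArg (Polynomial.map (PadicInt.toZMod (p := 3))) hk₀
    rw [Polynomial.map_map, hcomp, hFh, Polynomial.map_mul, Polynomial.map_sub, map_X, map_C, ha',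
      C_0, sub_zero] at h3
    exact (mul_left_cancel₀ X_ne_zero h3).symm
  have hk₀i : Irreducible (k₀.map (algebraMap ℤ_[3] ℚ_[3])) :=
    (hk₀m.irreducible_iff_irreducible_map_fraction_map).1
      (hk₀m.irreducible_of_irreducible_map (PadicInt.toZMod (p := 3)) _ (hk₀h ▸ hh))
  -- the embedding of `E` into `ℚ₃`
  have hroot : aeval (a : ℚ_[3]) (minpoly ℚ pb.gen) = 0 := by
    rw [hmin, aeval_map_algebraMap]
    have h4 := congrArg (algebraMap ℤ_[3] ℚ_[3]) ha
    rw [map_zero, aeval_def, hom_eval₂] at h4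
    rw [aeval_def, ← h4]
    rfl
  let j : E →ₐ[ℚ] ℚ_[3] := pb.lift (a : ℚ_[3]) hroot
  obtain ⟨k, hk⟩ : (X - C pb.gen) ∣ (minpoly ℚ pb.gen).map (algebraMap ℚ E) := by
    rw [dvd_iff_isRoot, IsRoot.def, eval_map_algebraMap, minpoly.aeval]
  have hkm : k.Monic := (monic_X_sub_C _).of_mul_monic_left
    (hk ▸ (minpoly.monic pb.isIntegral_gen).map _)
  refine ⟨k, hkm.irreducible_of_irreducible_map (j : E →+* ℚ_[3]) _ ?_, hk⟩
  have h5 := congrArg (Polynomial.map (j : E →+* ℚ_[3])) hk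
  have h6 := congrArg (Polynomial.map (algebraMap ℤ_[3] ℚ_[3])) hk₀
  rw [Polynomial.map_map, Polynomial.map_mul, Polynomial.map_sub, map_X, map_C] at h5 h6
  rw [hmin, Polynomial.map_map] at h5
  have e : ((j : E →+* ℚ_[3]).comp (algebraMap ℚ E)).comp (algebraMap ℤ ℚ) =
    (algebraMap ℤ_[3] ℚ_[3]).comp (algebraMap ℤ ℤ_[3]) := RingHom.ext_int _ _
  have e2 : (j : E →+* ℚ_[3]) pb.gen = algebraMap ℤ_[3] ℚ_[3] a := pb.lift_gen _ hroot
  rw [e, h6, e2] at h5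
  rw [← mul_left_cancel₀ (X_sub_C_ne_zero _) h5]
  exact hk₀i

theorem nrRealPlaces_eq_ncard {E : Type} [Field E] [NumberField E] (pb : PowerBasis ℚ E)
    {F : ℤ[X]} (hmin : minpoly ℚ pb.gen = F.map (algebraMap ℤ ℚ)) :
    InfinitePlace.nrRealPlaces E = {w : ℂ | aeval w F = 0 ∧ w.im = 0}.ncard := by
  classical
  rw [← InfinitePlace.card_real_embeddings, ← Nat.card_eq_fintype_card, ← Nat.card_coe_set_eq]
  have hex : ∀ φ ψ : E →+* ℂ, φ pb.gen = ψ pb.gen → φ = ψ := by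
    intro φ ψ h
    have : φ.toRatAlgHom = ψ.toRatAlgHom := pb.algHom_ext h
    ext x
    exact DFunLike.congr_fun this x
  refine Nat.card_congr (Equiv.ofBijective (fun φ => ⟨φ.1 pb.gen, ?_, ?_⟩) ⟨?_, ?_⟩)
  · have h1 := congrArg φ.1 (minpoly.aeval ℚ pb.gen)
    rw [hmin, aeval_map_algebraMap, map_zero, aeval_def, hom_eval₂] at h1
    rw [aeval_def, ← h1]
    congr 1
    exact RingHom.ext_int _ _
  · exact Complex.conj_eq_iff_im.1 (DFunLike.congr_fun φ.2 pb.gen)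
  · intro φ ψ h
    exact Subtype.ext (hex _ _ (congrArg Subtype.val h))
  · rintro ⟨w, hw, hw'⟩
    have hroot : aeval w (minpoly ℚ pb.gen) = 0 := by rwa [hmin, aeval_map_algebraMap]
    have hg : ((pb.lift w hroot : E →ₐ[ℚ] ℂ) : E →+* ℂ) pb.gen = w := pb.lift_gen w hroot
    refine ⟨⟨(pb.lift w hroot : E →ₐ[ℚ] ℂ), ?_⟩, Subtype.ext hg⟩
    refine hex _ _ ?_
    rw [ComplexEmbedding.conjugate_coe_eq, hg, Complex.conj_eq_iff_im.2 hw']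

/-- There are number fields with a doubly transitive Galois group and any given signature. -/
theorem exists_numberField {g r s : ℕ} (hg : 3 ≤ g) (hrs : r + 2 * s = g) :
    ∃ (E : Type) (_ : Field E) (_ : NumberField E) (L : Type) (_ : Field L) (_ : Algebra ℚ L)
      (ψ : E ⊗[ℚ] E →ₐ[ℚ] L), IsPairField ψ ∧ Module.finrank ℚ E = g ∧
        InfinitePlace.nrRealPlaces E = r ∧ InfinitePlace.nrComplexPlaces E = s := by
  obtain ⟨F, hF, hFd, hF2, ⟨h, hh, hhd, hF3⟩, hFr⟩ := exists_polynomial hg hrs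
  have hirr : Irreducible (F.map (algebraMap ℤ ℚ)) :=
    (hF.irreducible_iff_irreducible_map_fraction_map).1 (hF.irreducible_of_irreducible_map _ _ hF2)
  obtain ⟨E, hE, hA, pb, hpb⟩ : ∃ (E : Type) (_ : Field E) (_ : Algebra ℚ E) (pb : PowerBasis ℚ E),
      minpoly ℚ pb.gen = F.map (algebraMap ℤ ℚ) := by
    have : Fact (Irreducible (F.map (algebraMap ℤ ℚ))) := ⟨hirr⟩
    refine ⟨AdjoinRoot (F.map (algebraMap ℤ ℚ)), inferInstance, _,
      AdjoinRoot.powerBasis hirr.ne_zero,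
      AdjoinRoot.minpoly_powerBasis_gen_of_monic (hF.map (algebraMap ℤ ℚ))⟩
  have : CharZero E := algebraRat.charZero E
  have hA' : hA = DivisionRing.toRatAlgebra := Subsingleton.elim _ _
  subst hA'
  have := pb.finite
  have hNF : NumberField E := ⟨⟩
  have hdim : Module.finrank ℚ E = g := by
    rw [pb.finrank, ← pb.natDegree_minpoly, hpb, hF.natDegree_map, hFd]
  obtain ⟨k, hk, hfac⟩ := exists_factor_irreducible pb hF hpb hh (by omega) hF3
  obtain ⟨L, hL, hLA, ψ, hψ⟩ := exists_isPairField pb hk hfac (by omega)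
  have hr : InfinitePlace.nrRealPlaces E = r := by rw [nrRealPlaces_eq_ncard pb hpb, hFr]
  have hcard := InfinitePlace.card_add_two_mul_card_eq_rank E
  exact ⟨E, hE, hNF, L, hL, hLA, ψ, hψ, hdim, hr, by omega⟩

end NumberFields

/-! ### Generic units of `E ⊗ ℝ` -/

section Periods

open NumberField Module

/-- Partial fractions with distinct poles are linearly independent. -/
theorem finite_setOf_partialFraction_eq_zero {ι : Type*} [Fintype ι] {p : ι → ℂ}
    (hp : Function.Injective p) (K : ℂ) {c : ι → ℂ} (hc : c ≠ 0) :
    {t : ℝ | (∀ i, (t : ℂ) ≠ p i) ∧ K + ∑ i, c i / (t - p i) = 0}.Finite := by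
  classical
  let X : Polynomial ℂ := .X
  let C : ℂ →+* Polynomial ℂ := Polynomial.C
  let P : Polynomial ℂ := C K * ∏ j, (X - C (p j)) +
    ∑ i, C (c i) * ∏ j ∈ Finset.univ.erase i, (X - C (p j))
  have hev : ∀ t, P.eval t = K * ∏ j, (t - p j) +
      ∑ i, c i * ∏ j ∈ Finset.univ.erase i, (t - p j) := by
    intro t
    simp [P, X, C, Polynomial.eval_finsetSum, Polynomial.eval_prod]
  obtain ⟨i, hi⟩ := Function.ne_iff.1 hc
  have hP : P ≠ 0 := by
    intro h0
    have h1 := hev (p i)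
    rw [h0, Polynomial.eval_zero, Finset.prod_eq_zero (Finset.mem_univ i) (sub_self _), mul_zero,
      zero_add, Finset.sum_eq_single i] at h1
    · rcases mul_eq_zero.1 h1.symm with h2 | h2
      · exact hi h2
      · obtain ⟨j, hj, hj'⟩ := Finset.prod_eq_zero_iff.1 h2
        exact Finset.ne_of_mem_erase hj (hp (sub_eq_zero.1 hj')).symm
    · intro j _ hj
      rw [Finset.prod_eq_zero (Finset.mem_erase.2 ⟨hj.symm, Finset.mem_univ i⟩) (sub_self _),
        mul_zero]
    · intro h; exact absurd (Finset.mem_univ i) h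
  refine (((Polynomial.finite_setOfPred_isRoot hP).preimage
    Complex.ofReal_injective.injOn)).subset ?_
  rintro t ⟨ht, h0⟩
  change P.eval (t : ℂ) = 0
  rw [hev]
  have h1 : ∀ i, ∏ j ∈ Finset.univ.erase i, ((t : ℂ) - p j) =
      (∏ j, ((t : ℂ) - p j)) / (t - p i) := fun i => by
    rw [eq_div_iff (sub_ne_zero.2 (ht i)), mul_comm,
      Finset.mul_prod_erase _ (fun j => (t : ℂ) - p j) (Finset.mem_univ i)]
  simp_rw [h1]
  calc _ = (∏ j, ((t : ℂ) - p j)) * (K + ∑ i, c i / (t - p i)) := by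
        rw [mul_add, Finset.mul_sum, mul_comm K]
        congr 1
        exact Finset.sum_congr rfl fun i _ => by ring
    _ = 0 := by rw [h0, mul_zero]

theorem exists_partialFraction_ne_zero {ι J : Type*} [Fintype ι] [Countable J] {p : ι → ℂ}
    (hp : Function.Injective p) (K : J → ℂ) (c : J → ι → ℂ) :
    ∃ t : ℝ, (∀ i, (t : ℂ) ≠ p i) ∧ ∀ j, K j + ∑ i, c j i / (t - p i) = 0 → c j = 0 := by
  let bad : Set ℝ := (⋃ i, {t : ℝ | (t : ℂ) = p i}) ∪ ⋃ j : {j // c j ≠ 0},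
    {t : ℝ | (∀ i, (t : ℂ) ≠ p i) ∧ K j + ∑ i, c j i / (t - p i) = 0}
  have hbad : bad.Countable := by
    refine Set.Countable.union (Set.countable_iUnion fun i => ?_)
      (Set.countable_iUnion fun j => (finite_setOf_partialFraction_eq_zero hp _ j.2).countable)
    exact ((Set.finite_singleton (p i)).preimage Complex.ofReal_injective.injOn).countable
  obtain ⟨t, ht⟩ : ∃ t, t ∉ bad := by
    by_contra! h
    exact Set.not_countable_univ (hbad.mono fun t _ => h t)
  have h1 : ∀ i, (t : ℂ) ≠ p i := fun i hi => ht (Or.inl (Set.mem_iUnion.2 ⟨i, hi⟩))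
  exact ⟨t, h1, fun j hj => by_contra fun hne =>
    ht (Or.inr (Set.mem_iUnion.2 ⟨⟨j, hne⟩, h1, hj⟩))⟩

variable (E : Type) [Field E]

/-- The algebra `E ⊗ ℂ`, realized as the space of functions on the set of complex embeddings. -/
abbrev EmbSpace : Type := (E →+* ℂ) → ℂ

/-- The complex conjugation of `E ⊗ ℂ`, whose fixed points form `E ⊗ ℝ`. -/
noncomputable def embConj : EmbSpace E →ₗ[ℝ] EmbSpace E where
  toFun z σ := starRingEnd ℂ (z (ComplexEmbedding.conjugate σ))
  map_add' x y := by ext; simp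
  map_smul' c x := by ext; simp

variable {E}

theorem embConj_apply (z : EmbSpace E) (σ : E →+* ℂ) :
    embConj E z σ = starRingEnd ℂ (z (ComplexEmbedding.conjugate σ)) := rfl

theorem embConj_embConj (z : EmbSpace E) : embConj E (embConj E z) = z := by
  ext σ
  simp [embConj_apply]

theorem embConj_mul (z z' : EmbSpace E) : embConj E (z * z') = embConj E z * embConj E z' := by
  ext σ
  simp [embConj_apply]

theorem embConj_smul (c : ℂ) (z : EmbSpace E) :
    embConj E (c • z) = starRingEnd ℂ c • embConj E z := by
  ext σ
  simp [embConj_apply]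

theorem embConj_canonicalEmbedding (x : E) :
    embConj E (canonicalEmbedding E x) = canonicalEmbedding E x := by
  ext σ
  simp [embConj_apply, ComplexEmbedding.conjugate_coe_eq]

variable [NumberField E]

/-- An element of `E ⊗ ℂ` that is fixed by complex conjugation has real coordinates in a rational
basis. -/
theorem repr_of_embConj_eq {z : EmbSpace E} (hz : embConj E z = z) (k) :
    (((canonicalEmbedding.latticeBasis E).repr z k).re : ℂ) =
      (canonicalEmbedding.latticeBasis E).repr z k := by
  set b := canonicalEmbedding.latticeBasis E
  have h1 : ∑ k, starRingEnd ℂ (b.repr z k) • b k = z := by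
    conv_rhs => rw [← hz, ← b.sum_repr z, map_sum]
    refine Finset.sum_congr rfl fun k _ => ?_
    rw [embConj_smul, canonicalEmbedding.latticeBasis_apply, embConj_canonicalEmbedding]
  have h2 := congrArg (fun y => b.repr y k) h1
  simp only [map_sum, map_smul, Basis.repr_self] at h2
  rw [Finsupp.finsetSum_apply] at h2
  simp only [Finsupp.smul_single, smul_eq_mul, mul_one, Finsupp.single_apply] at h2
  rw [Finset.sum_ite_eq' Finset.univ k, if_pos (Finset.mem_univ k)] at h2
  exact Complex.conj_eq_iff_re.1 h2

variable (E)

/-- A unit `v = ∑ vₖ ωₖ` of `E ⊗ ℝ` with inverse `w = ∑ wₖ ωₖ`, where `(ωₖ)` is an integral basis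
of `E`, such that the real numbers `vₖ` and `wₖ` are linearly independent over `ℚ`. -/
structure GenericUnit where
  /-- The coordinates of the unit. -/
  vc : Free.ChooseBasisIndex ℤ (𝓞 E) → ℝ
  /-- The coordinates of the inverse of the unit. -/
  wc : Free.ChooseBasisIndex ℤ (𝓞 E) → ℝ
  mul_eq_one : (∑ k, vc k • canonicalEmbedding E (integralBasis E k)) *
    (∑ k, wc k • canonicalEmbedding E (integralBasis E k)) = 1
  linearIndependent : LinearIndependent ℚ (Sum.elim vc wc)

variable {E}

/-- Every rational functional on `E` is the trace of a multiplication. -/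
theorem exists_trace_mul_eq (p : Free.ChooseBasisIndex ℤ (𝓞 E) → ℚ) :
    ∃ β : E, ∀ k, Algebra.trace ℚ E (β * integralBasis E k) = p k := by
  let l : Dual ℚ E := (integralBasis E).constr ℚ p
  have hnd := traceForm_nondegenerate ℚ E
  refine ⟨(LinearMap.BilinForm.toDual _ hnd).symm l, fun k => ?_⟩
  have := LinearMap.BilinForm.apply_toDual_symm_apply (hB := hnd) l (integralBasis E k)
  rw [Algebra.traceForm_apply] at this
  rw [this, Basis.constr_basis]

theorem sum_embeddings_eq_trace (x : E) :
    ∑ σ : E →+* ℂ, σ x = (Algebra.trace ℚ E x : ℂ) := by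
  have := trace_eq_sum_embeddings (K := ℚ) (L := E) ℂ (x := x)
  rw [eq_ratCast] at this
  rw [this]
  exact Fintype.sum_equiv (RingHom.equivRatAlgHom E ℂ) _ _ fun σ => rfl

theorem sum_embeddings_mul {β : E} {p : Free.ChooseBasisIndex ℤ (𝓞 E) → ℚ}
    (hβ : ∀ k, Algebra.trace ℚ E (β * integralBasis E k) = p k) (z : EmbSpace E) :
    ∑ σ : E →+* ℂ, σ β * z σ =
      ∑ k, (p k : ℂ) * (canonicalEmbedding.latticeBasis E).repr z k := by
  conv_lhs => rw [← (canonicalEmbedding.latticeBasis E).sum_repr z]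
  simp only [Finset.sum_apply, Pi.smul_apply, smul_eq_mul, Finset.mul_sum,
    canonicalEmbedding.latticeBasis_apply, canonicalEmbedding.apply_at]
  rw [Finset.sum_comm]
  refine Finset.sum_congr rfl fun k _ => ?_
  rw [← hβ k, ← sum_embeddings_eq_trace, Finset.sum_mul]
  refine Finset.sum_congr rfl fun σ _ => ?_
  rw [map_mul]
  ring

variable (E) in
/-- The unit is `(t - θ) / (t + c - θ)` for a generator `θ` of `E` and real numbers `c` and `t`,
where `t` avoids the countably many solutions of the linear relations. These relations are
nontrivial, because the conjugates of `v` and `w` are partial fractions in `t` with distinct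
poles. -/
theorem exists_genericUnit : Nonempty (GenericUnit E) := by
  let pb := Field.powerBasisOfFiniteOfSeparable ℚ E
  have hθ : Function.Injective fun σ : E →+* ℂ => σ pb.gen := by
    intro σ τ h
    have : σ.toRatAlgHom = τ.toRatAlgHom := pb.algHom_ext h
    ext x
    exact DFunLike.congr_fun this x
  generalize pb.gen = θ at hθ
  obtain ⟨c, hc⟩ : ∃ c : ℝ, ∀ σ τ : E →+* ℂ, σ θ - τ θ ≠ c := by
    have hfin : (⋃ σ : E →+* ℂ, ⋃ τ : E →+* ℂ, {c : ℝ | (c : ℂ) = σ θ - τ θ}).Finite :=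
      Set.finite_iUnion fun σ => Set.finite_iUnion fun τ =>
        (Set.finite_singleton (σ θ - τ θ)).preimage Complex.ofReal_injective.injOn
    obtain ⟨c, hc⟩ := hfin.exists_notMem
    exact ⟨c, fun σ τ h => hc (Set.mem_iUnion.2 ⟨σ, Set.mem_iUnion.2 ⟨τ, h.symm⟩⟩)⟩
  have hc0 : (c : ℂ) ≠ 0 := fun h0 => by
    obtain ⟨σ⟩ := (inferInstance : Nonempty (E →+* ℂ))
    exact hc σ σ (by rw [h0, sub_self])
  let p : (E →+* ℂ) ⊕ (E →+* ℂ) → ℂ := Sum.elim (fun σ => σ θ - c) (fun σ => σ θ)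
  have hp : Function.Injective p := by
    rintro (σ | σ) (τ | τ) h <;> simp only [p, Sum.elim_inl, Sum.elim_inr] at h
    · rw [hθ (sub_left_injective h)]
    · exact absurd (by linear_combination h) (hc σ τ)
    · exact absurd (by linear_combination -h) (hc τ σ)
    · rw [hθ h]
  have : Countable E := (integralBasis E).equivFun.injective.countable
  obtain ⟨t, ht, hgen⟩ := exists_partialFraction_ne_zero hp
    (fun j : E × E => ∑ σ : E →+* ℂ, (σ j.1 + σ j.2))
    (fun j => Sum.elim (fun σ => -c * σ j.1) (fun σ => c * σ j.2))
  have ht1 : ∀ σ : E →+* ℂ, (t : ℂ) - (σ θ - c) ≠ 0 := fun σ => sub_ne_zero.2 (ht (.inl σ))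
  have ht2 : ∀ σ : E →+* ℂ, (t : ℂ) - σ θ ≠ 0 := fun σ => sub_ne_zero.2 (ht (.inr σ))
  let v : EmbSpace E := fun σ => (t - σ θ) / (t - (σ θ - c))
  let w : EmbSpace E := fun σ => (t - (σ θ - c)) / (t - σ θ)
  have hvw : v * w = 1 := by
    ext σ
    simp only [v, w, Pi.mul_apply, Pi.one_apply]
    field_simp [ht1 σ, ht2 σ]
  have hv : embConj E v = v := by
    ext σ
    simp [embConj_apply, v, ComplexEmbedding.conjugate_coe_eq]
  have hw : embConj E w = w := by
    ext σ
    simp [embConj_apply, w, ComplexEmbedding.conjugate_coe_eq]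
  set b := canonicalEmbedding.latticeBasis E with hb
  have hsum : ∀ z : EmbSpace E, embConj E z = z →
      ∑ k, (b.repr z k).re • canonicalEmbedding E (integralBasis E k) = z := by
    intro z hz
    conv_rhs => rw [← b.sum_repr z]
    refine Finset.sum_congr rfl fun k _ => ?_
    rw [← repr_of_embConj_eq hz k, hb, canonicalEmbedding.latticeBasis_apply, Complex.ofReal_re,
      Complex.coe_smul]
  refine ⟨⟨fun k => (b.repr v k).re, fun k => (b.repr w k).re, ?_, ?_⟩⟩
  · rw [hsum v hv, hsum w hw, hvw]
  · rw [Fintype.linearIndependent_iff]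
    intro q hq
    obtain ⟨β, hβ⟩ := exists_trace_mul_eq (E := E) fun k => q (.inl k)
    obtain ⟨γ, hγ⟩ := exists_trace_mul_eq (E := E) fun k => q (.inr k)
    have h1 : ∑ σ : E →+* ℂ, σ β * v σ + ∑ σ : E →+* ℂ, σ γ * w σ = 0 := by
      rw [sum_embeddings_mul hβ, sum_embeddings_mul hγ, ← hb]
      have h2 := congrArg (fun x : ℝ => (x : ℂ)) hq
      simp only [Fintype.sum_sum_type, Sum.elim_inl, Sum.elim_inr, Complex.ofReal_add,
        Complex.ofReal_sum, Rat.smul_def, Complex.ofReal_mul, Complex.ofReal_ratCast,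
        repr_of_embConj_eq hv, repr_of_embConj_eq hw, Complex.ofReal_zero, hb] at h2
      exact h2
    have h3 := hgen (β, γ) (by
      rw [← h1, Fintype.sum_sum_type, ← Finset.sum_add_distrib, ← Finset.sum_add_distrib,
        ← Finset.sum_add_distrib]
      refine Finset.sum_congr rfl fun σ _ => ?_
      simp only [Sum.elim_inl, Sum.elim_inr, p, v, w]
      have := ht1 σ
      have := ht2 σ
      field_simp
      ring)
    obtain ⟨σ⟩ := (inferInstance : Nonempty (E →+* ℂ))
    have hβ0 : β = 0 := by
      have := congrFun h3 (.inl σ)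
      simpa [hc0] using this
    have hγ0 : γ = 0 := by
      have := congrFun h3 (.inr σ)
      simpa [hc0] using this
    rintro (k | k)
    · rw [← hβ k, hβ0, zero_mul, map_zero]
    · rw [← hγ k, hγ0, zero_mul, map_zero]

end Periods

/-! ### The torus of a generic unit -/

namespace GenericUnit

open NumberField Module

variable {E : Type} [Field E]

/-- The projection of `E ⊗ ℂ = E ⊗ ℝ + i v (E ⊗ ℝ)` to the first summand, which does not depend on
the unit `v` of `E ⊗ ℝ`. -/
noncomputable def fst : EmbSpace E →ₗ[ℝ] EmbSpace E :=
  (1 / 2 : ℝ) • (LinearMap.id + embConj E)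

theorem fst_apply (z : EmbSpace E) : fst z = (1 / 2 : ℂ) • (z + embConj E z) := by
  change (1 / 2 : ℝ) • (z + embConj E z) = _
  ext σ
  simp [mul_add]

variable [NumberField E] (P : GenericUnit E)

/-- The generic unit `v` of `E ⊗ ℝ`. -/
noncomputable def v : EmbSpace E := ∑ k, P.vc k • canonicalEmbedding E (integralBasis E k)

/-- The inverse of the generic unit `v`. -/
noncomputable def w : EmbSpace E := ∑ k, P.wc k • canonicalEmbedding E (integralBasis E k)

theorem v_mul_w : P.v * P.w = 1 := P.mul_eq_one

theorem embConj_v : embConj E P.v = P.v := by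
  simp only [v, map_sum, map_smul, embConj_canonicalEmbedding]

theorem embConj_w : embConj E P.w = P.w := by
  simp only [w, map_sum, map_smul, embConj_canonicalEmbedding]

/-- The map `x + i v y ↦ y` from `E ⊗ ℂ = E ⊗ ℝ + i v (E ⊗ ℝ)` to `E ⊗ ℝ`. -/
noncomputable def snd : EmbSpace E →ₗ[ℝ] EmbSpace E :=
  LinearMap.mulLeft ℝ ((-Complex.I / 2) • P.w) ∘ₗ (LinearMap.id - embConj E)

theorem snd_apply (z : EmbSpace E) :
    P.snd z = (-Complex.I / 2) • (P.w * (z - embConj E z)) := by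
  change (-Complex.I / 2) • P.w * (z - embConj E z) = _
  rw [smul_mul_assoc]

theorem fst_add_snd (z : EmbSpace E) : fst z + Complex.I • (P.v * P.snd z) = z := by
  have h : -(Complex.I * Complex.I) = 1 := by simp
  rw [fst_apply, snd_apply, mul_smul_comm, ← mul_assoc, v_mul_w, one_mul, smul_smul, mul_div_assoc',
    mul_neg, h]
  module

theorem fst_of_embConj_eq {x y : EmbSpace E} (hx : embConj E x = x) (hy : embConj E y = y) :
    fst (x + Complex.I • (P.v * y)) = x := by
  rw [fst_apply, map_add, embConj_smul, embConj_mul, P.embConj_v, hx, hy, Complex.conj_I]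
  module

theorem snd_of_embConj_eq {x y : EmbSpace E} (hx : embConj E x = x) (hy : embConj E y = y) :
    P.snd (x + Complex.I • (P.v * y)) = y := by
  have h : -(Complex.I * Complex.I) = 1 := by simp
  rw [snd_apply, map_add, embConj_smul, embConj_mul, P.embConj_v, hx, hy, Complex.conj_I]
  have : x + Complex.I • (P.v * y) - (x + -Complex.I • (P.v * y)) =
      (2 * Complex.I) • (P.v * y) := by module
  rw [this, mul_smul_comm, ← mul_assoc, mul_comm P.w, v_mul_w, one_mul, smul_smul]
  have : -Complex.I / 2 * (2 * Complex.I) = 1 := by linear_combination h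
  rw [this, one_smul]

/-- The point `x + i v y` of `E ⊗ ℂ`, for `x`, `y` in `E`. -/
noncomputable def pt (x y : E) : EmbSpace E :=
  canonicalEmbedding E x + Complex.I • (P.v * canonicalEmbedding E y)

@[simp]
theorem fst_pt (x y : E) : fst (P.pt x y) = canonicalEmbedding E x :=
  P.fst_of_embConj_eq (embConj_canonicalEmbedding x) (embConj_canonicalEmbedding y)

@[simp]
theorem snd_pt (x y : E) : P.snd (P.pt x y) = canonicalEmbedding E y :=
  P.snd_of_embConj_eq (embConj_canonicalEmbedding x) (embConj_canonicalEmbedding y)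

theorem pt_add (x y x' y' : E) : P.pt (x + x') (y + y') = P.pt x y + P.pt x' y' := by
  simp only [pt, map_add, mul_add, smul_add]
  abel

theorem pt_zero : P.pt 0 0 = 0 := by simp [pt]

theorem pt_neg (x y : E) : P.pt (-x) (-y) = -P.pt x y := by
  simp only [pt, map_neg, mul_neg, smul_neg]
  abel

/-- A real basis of `E ⊗ ℂ` that consists of `ωₖ` and `i v ωₖ`, for an integral basis `(ωₖ)`. -/
noncomputable def realBasis :
    Basis (Free.ChooseBasisIndex ℤ (𝓞 E) ⊕ Free.ChooseBasisIndex ℤ (𝓞 E)) ℝ (EmbSpace E) :=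
  basisOfLinearIndependentOfCardEqFinrank
    (b := Sum.elim (fun k => P.pt (integralBasis E k) 0) fun k => P.pt 0 (integralBasis E k))
    (by
      have hind : ∀ a : Free.ChooseBasisIndex ℤ (𝓞 E) → ℝ,
          ∑ k, a k • canonicalEmbedding E (integralBasis E k) = 0 → ∀ k, a k = 0 := by
        intro a ha k
        have h1 := Fintype.linearIndependent_iff.1 (canonicalEmbedding.latticeBasis E).linearIndependent
          (fun k => (a k : ℂ)) (by
            rw [← ha]
            refine Finset.sum_congr rfl fun k _ => ?_
            rw [canonicalEmbedding.latticeBasis_apply, Complex.coe_smul]) k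
        exact_mod_cast h1
      rw [Fintype.linearIndependent_iff]
      intro a ha
      simp only [Fintype.sum_sum_type, Sum.elim_inl, Sum.elim_inr] at ha
      have h1 := congrArg fst ha
      have h2 := congrArg P.snd ha
      simp only [map_add, map_sum, map_smul, fst_pt, snd_pt, map_zero, smul_zero,
        Finset.sum_const_zero, add_zero, zero_add] at h1 h2
      rintro (k | k)
      · exact hind _ h1 k
      · exact hind _ h2 k)
    (by
      rw [finrank_real_of_complex, finrank_eq_card_basis (canonicalEmbedding.latticeBasis E),
        Fintype.card_sum, two_mul])

theorem realBasis_inl (k) : P.realBasis (.inl k) = P.pt (integralBasis E k) 0 := by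
  simp [realBasis]

theorem realBasis_inr (k) : P.realBasis (.inr k) = P.pt 0 (integralBasis E k) := by
  simp [realBasis]

/-- The lattice `𝓞 + i v 𝓞` in `E ⊗ ℂ`, where `𝓞` is the ring of integers of `E`. -/
noncomputable abbrev lattice : Submodule ℤ (EmbSpace E) :=
  Submodule.span ℤ (Set.range P.realBasis)

theorem mem_lattice_iff {z : EmbSpace E} : z ∈ P.lattice ↔
    ∃ x y : 𝓞 E, z = P.pt (algebraMap (𝓞 E) E x) (algebraMap (𝓞 E) E y) := by
  constructor
  · intro hz
    induction hz using Submodule.span_induction with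
    | mem z hz =>
      obtain ⟨k | k, rfl⟩ := hz
      · exact ⟨RingOfIntegers.basis E k, 0, by rw [realBasis_inl, integralBasis_apply, map_zero]⟩
      · exact ⟨0, RingOfIntegers.basis E k, by rw [realBasis_inr, integralBasis_apply, map_zero]⟩
    | zero => exact ⟨0, 0, by rw [map_zero, pt_zero]⟩
    | add z z' _ _ hz hz' =>
      obtain ⟨x, y, rfl⟩ := hz
      obtain ⟨x', y', rfl⟩ := hz'
      exact ⟨x + x', y + y', by rw [map_add, map_add, pt_add]⟩
    | smul n z _ hz =>
      obtain ⟨x, y, rfl⟩ := hz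
      exact ⟨n • x, n • y, by
        simp only [pt, zsmul_eq_mul, map_mul, map_intCast, smul_add, mul_smul_comm]
        rw [mul_left_comm P.v]⟩
  · rintro ⟨x, y, rfl⟩
    have hspan : ∀ (f : E →+ EmbSpace E),
        (∀ k, f (integralBasis E k) ∈ P.lattice) → ∀ x : 𝓞 E, f (algebraMap (𝓞 E) E x) ∈ P.lattice := by
      intro f hf x
      have h1 : Submodule.span ℤ (Set.range (integralBasis E)) ≤
          P.lattice.comap f.toIntLinearMap := by
        rw [Submodule.span_le]
        rintro _ ⟨k, rfl⟩
        exact hf k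
      exact h1 ((mem_span_integralBasis E).2 ⟨x, rfl⟩)
    rw [← add_zero (algebraMap (𝓞 E) E x), ← zero_add (algebraMap (𝓞 E) E y), pt_add]
    refine add_mem (hspan ⟨⟨fun x => P.pt x 0, P.pt_zero⟩, fun x y => ?_⟩ (fun k => ?_) x)
      (hspan ⟨⟨fun x => P.pt 0 x, P.pt_zero⟩, fun x y => ?_⟩ (fun k => ?_) y)
    · simp [← pt_add]
    · exact Submodule.subset_span ⟨.inl k, P.realBasis_inl k⟩
    · simp [← pt_add]
    · exact Submodule.subset_span ⟨.inr k, P.realBasis_inr k⟩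

/-- The complex torus `(E ⊗ ℂ) / (𝓞 + i v 𝓞)`. -/
noncomputable def torus : ComplexTorus where
  V := EmbSpace E
  Λ := P.lattice

theorem torus_dim : P.torus.dim = finrank ℚ E := by
  change finrank ℂ (EmbSpace E) = _
  rw [finrank_fintype_fun_eq_card, Embeddings.card]

/-- The generic unit has the property that a real-linear relation with coefficients `vₖ` and `wₖ`
between points of `E + i v E` is trivial. -/
theorem pt_eq_zero_of_sum_eq_zero
    {a b c d : Free.ChooseBasisIndex ℤ (𝓞 E) → E}
    (h : ∑ k, P.vc k • P.pt (a k) (b k) + ∑ k, P.wc k • P.pt (c k) (d k) = 0) :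
    a = 0 ∧ b = 0 ∧ c = 0 ∧ d = 0 := by
  have key : ∀ a c : Free.ChooseBasisIndex ℤ (𝓞 E) → E,
      ∑ k, P.vc k • canonicalEmbedding E (a k) + ∑ k, P.wc k • canonicalEmbedding E (c k) = 0 →
      a = 0 ∧ c = 0 := by
    intro a c hac
    have hrepr : ∀ i, Sum.elim (fun k => (integralBasis E).repr (a k) i)
        (fun k => (integralBasis E).repr (c k) i) = 0 := by
      intro i
      have h1 := congrArg (fun z => (canonicalEmbedding.latticeBasis E).repr z i) hac
      simp only [← Complex.coe_smul, map_add, map_sum, map_smul, map_zero] at h1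
      rw [Finsupp.add_apply, Finsupp.finsetSum_apply, Finsupp.finsetSum_apply] at h1
      simp only [Finsupp.smul_apply, canonicalEmbedding.integralBasis_repr_apply, smul_eq_mul,
        Finsupp.zero_apply] at h1
      funext j
      refine Fintype.linearIndependent_iff.1 P.linearIndependent _ ?_ j
      simp only [Fintype.sum_sum_type, Sum.elim_inl, Sum.elim_inr, Rat.smul_def]
      simp only [mul_comm ((_ : ℚ) : ℝ)]
      exact_mod_cast h1
    constructor <;> funext k <;> apply (integralBasis E).repr.injective <;> ext i
    · simpa using congrFun (hrepr i) (.inl k)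
    · simpa using congrFun (hrepr i) (.inr k)
  have h1 := congrArg fst h
  have h2 := congrArg P.snd h
  simp only [map_add, map_sum, map_smul, fst_pt, snd_pt, map_zero] at h1 h2
  exact ⟨(key a c h1).1, (key b d h2).1, (key a c h1).2, (key b d h2).2⟩

end GenericUnit

/-! ### Endomorphisms of the torus -/

namespace ComplexTorus

open Filter Topology

/-- A holomorphic endomorphism of a complex torus lifts to a complex-linear map: a local
holomorphic lift that vanishes at `0` is additive near `0`, because its deviation from additivity
is small and takes values in the discrete group `Λ`; hence it coincides near `0` with its
derivative at `0`. -/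
theorem exists_linear_lift (T : ComplexTorus) {f : AddMonoid.End T.Pt} (hf : T.IsHolomorphic f) :
    ∃ A : T.V →ₗ[ℂ] T.V, ∀ z, T.proj (A z) = f (T.proj z) := by
  obtain ⟨U, hU, h0U, F, hF, hFf⟩ := hf 0
  have hUn : U ∈ 𝓝 (0 : T.V) := hU.mem_nhds h0U
  have hdiff : DifferentiableAt ℂ F 0 := (hF 0 h0U).differentiableAt hUn
  have hcont : ContinuousAt F 0 := hdiff.continuousAt
  -- the local lift that vanishes at `0`
  set G : T.V → T.V := fun y => F y - F 0 with hG
  have hG0 : G 0 = 0 := sub_self _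
  have hGcont : ContinuousAt G 0 := hcont.sub continuousAt_const
  have hFΛ : T.proj (F 0) = 0 := by rw [hFf 0 h0U, map_zero, map_zero]
  have hGf : ∀ y ∈ U, T.proj (G y) = f (T.proj y) := by
    intro y hy
    rw [hG, map_sub, hFΛ, sub_zero, hFf y hy]
  obtain ⟨ε, hε, hεΛ⟩ : ∃ ε > 0, ∀ z ∈ T.Λ, ‖z‖ < ε → z = 0 := by
    obtain ⟨ε, hε, h⟩ := Metric.isOpen_singleton_iff.1 (isOpen_discrete ({0} : Set T.Λ))
    refine ⟨ε, hε, fun z hz hzε => congrArg Subtype.val (h ⟨z, hz⟩ ?_)⟩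
    rwa [dist_zero_right]
  obtain ⟨δ, hδ, hδU⟩ : ∃ δ > 0, ∀ y : T.V, ‖y‖ < δ → y ∈ U ∧ ‖G y‖ < ε / 3 := by
    have h1 : ∀ᶠ y in 𝓝 (0 : T.V), y ∈ U ∧ ‖G y‖ < ε / 3 := by
      refine (eventually_mem_set.2 hUn).and ?_
      have := hGcont.norm.tendsto
      rw [hG0, norm_zero] at this
      exact this.eventually_lt_const (by positivity)
    obtain ⟨δ, hδ, h⟩ := Metric.eventually_nhds_iff.1 h1
    exact ⟨δ, hδ, fun y hy => h (by rwa [dist_zero_right])⟩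
  have hadd : ∀ y y' : T.V, ‖y‖ < δ → ‖y'‖ < δ → ‖y + y'‖ < δ → G (y + y') = G y + G y' := by
    intro y y' hy hy' hyy'
    rw [← sub_eq_zero]
    apply hεΛ
    · rw [← Submodule.Quotient.mk_eq_zero]
      change T.proj _ = 0
      rw [map_sub, map_add, hGf _ (hδU _ hy).1, hGf _ (hδU _ hy').1, hGf _ (hδU _ hyy').1,
        map_add, map_add, sub_self]
    · have h1 := norm_sub_le (G (y + y')) (G y + G y')
      have h2 := norm_add_le (G y) (G y')
      linarith [(hδU _ hy).2, (hδU _ hy').2, (hδU _ hyy').2]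
  have hhalf : ∀ (n : ℕ) (y : T.V), ‖y‖ < δ → G y = (2 : ℂ) ^ n • G (((2 : ℂ) ^ n)⁻¹ • y) := by
    intro n
    induction n with
    | zero => intro y _; simp
    | succ n ih =>
      intro y hy
      set y' := ((2 : ℂ) ^ (n + 1))⁻¹ • y
      have hsum : ((2 : ℂ) ^ n)⁻¹ • y = y' + y' := by
        rw [← two_smul ℂ y', smul_smul, pow_succ, mul_inv]
        congr 1
        field_simp
      have hle : ∀ m : ℕ, ‖((2 : ℂ) ^ m)⁻¹ • y‖ < δ := by
        intro m
        refine lt_of_le_of_lt ?_ hy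
        rw [norm_smul, norm_inv, norm_pow, Complex.norm_ofNat]
        refine mul_le_of_le_one_left (norm_nonneg _) (inv_le_one_of_one_le₀ (one_le_pow₀ one_le_two))
      rw [ih y hy, hsum, hadd y' y' (hle _) (hle _) (hsum ▸ hle n), ← two_smul ℂ (G y'), smul_smul,
        pow_succ]
  have hderiv : HasFDerivAt G (fderiv ℂ F 0) 0 := hdiff.hasFDerivAt.sub_const _
  set A := fderiv ℂ F 0
  have hGA : ∀ y : T.V, ‖y‖ < δ → G y = A y := by
    intro y hy
    have h1 : Tendsto (fun n : ℕ => (2 : ℂ) ^ n • (G (0 + ((2 : ℂ) ^ n)⁻¹ • y) - G 0)) atTop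
        (𝓝 (A y)) := by
      refine hderiv.lim y ?_
      simp only [norm_pow, Complex.norm_ofNat]
      exact tendsto_pow_atTop_atTop_of_one_lt one_lt_two
    simp only [zero_add, hG0, sub_zero, ← hhalf _ y hy] at h1
    exact tendsto_nhds_unique tendsto_const_nhds h1
  refine ⟨A, fun z => ?_⟩
  obtain ⟨n, hn⟩ := exists_nat_gt (‖z‖ / δ)
  have hn0 : (0 : ℝ) < n := lt_of_le_of_lt (by positivity) hn
  set y := ((n : ℂ))⁻¹ • z
  have hy : ‖y‖ < δ := by
    rw [norm_smul, norm_inv, Complex.norm_natCast, inv_mul_lt_iff₀ hn0]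
    rwa [div_lt_iff₀ hδ] at hn
  have hz : z = n • y := by
    rw [← Nat.cast_smul_eq_nsmul ℂ, smul_smul, mul_inv_cancel₀ (by exact_mod_cast hn0.ne'), one_smul]
  change T.proj (A z) = _
  rw [hz, map_nsmul, map_nsmul, ← hGA y hy, hGf y (hδU y hy).1, map_nsmul, map_nsmul]

end ComplexTorus

namespace GenericUnit

open NumberField Module

variable {E : Type} [Field E] [NumberField E] (P : GenericUnit E)

theorem mul_pt (e x y : E) : canonicalEmbedding E e * P.pt x y = P.pt (e * x) (e * y) := by
  simp only [pt, mul_add, map_mul, mul_smul_comm]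
  rw [mul_left_comm _ P.v]

/-- The multiplication by an element of `E` on `E ⊗ ℂ`. -/
noncomputable def mulMap (e : E) : EmbSpace E →ₗ[ℂ] EmbSpace E :=
  LinearMap.mulLeft ℂ (canonicalEmbedding E e)

theorem mulMap_mem (e : 𝓞 E) : P.lattice ≤ P.lattice.comap
    ((mulMap (algebraMap (𝓞 E) E e)).restrictScalars ℤ) := by
  intro z hz
  obtain ⟨x, y, rfl⟩ := P.mem_lattice_iff.1 hz
  refine P.mem_lattice_iff.2 ⟨e * x, e * y, ?_⟩
  rw [map_mul, map_mul]
  exact P.mul_pt _ _ _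

/-- The action of the ring of integers of `E` on the torus. -/
noncomputable def intAction : 𝓞 E →+* P.torus.endRing where
  toFun e := ⟨(P.lattice.mapQ P.lattice _ (P.mulMap_mem e)).toAddMonoidHom, fun x =>
    ⟨Set.univ, isOpen_univ, Set.mem_univ x, mulMap (algebraMap (𝓞 E) E e),
      (LinearMap.toContinuousLinearMap (mulMap (algebraMap (𝓞 E) E e))).differentiable.differentiableOn,
      fun y _ => rfl⟩⟩
  map_one' := by
    ext z
    obtain ⟨(z : EmbSpace E), rfl⟩ := Submodule.mkQ_surjective P.lattice z
    change P.lattice.mkQ (_ * z) = P.lattice.mkQ z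
    rw [map_one, map_one, one_mul]
  map_mul' a b := by
    ext z
    obtain ⟨(z : EmbSpace E), rfl⟩ := Submodule.mkQ_surjective P.lattice z
    change P.lattice.mkQ (_ * z) = P.lattice.mkQ (_ * (_ * z))
    rw [RingHom.map_mul, RingHom.map_mul, mul_assoc]
  map_zero' := by
    ext z
    obtain ⟨(z : EmbSpace E), rfl⟩ := Submodule.mkQ_surjective P.lattice z
    change P.lattice.mkQ (_ * z) = 0
    rw [map_zero, map_zero, zero_mul, map_zero]
  map_add' a b := by
    ext z
    obtain ⟨(z : EmbSpace E), rfl⟩ := Submodule.mkQ_surjective P.lattice z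
    change P.lattice.mkQ (_ * z) = P.lattice.mkQ (_ * z) + P.lattice.mkQ (_ * z)
    rw [map_add, map_add, add_mul, map_add]

theorem intAction_apply (e : 𝓞 E) (z : EmbSpace E) :
    (P.intAction e).1 (P.lattice.mkQ z) =
      P.lattice.mkQ (canonicalEmbedding E (algebraMap (𝓞 E) E e) * z) := rfl

theorem pt_injective {x y x' y' : E} (h : P.pt x y = P.pt x' y') : x = x' ∧ y = y' := by
  have h1 := congrArg fst h
  have h2 := congrArg P.snd h
  rw [fst_pt, fst_pt] at h1
  rw [snd_pt, snd_pt] at h2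
  exact ⟨canonicalEmbedding_injective E h1, canonicalEmbedding_injective E h2⟩

theorem intAction_injective : Function.Injective P.intAction := by
  rw [injective_iff_map_eq_zero]
  intro e he
  by_contra hne
  have hne' : algebraMap (𝓞 E) E e ≠ 0 := by simpa using hne
  -- `e` maps the point `1 / (2 e)` to `1 / 2`, which does not belong to the lattice
  have h1 := P.intAction_apply e (P.pt ((2 * algebraMap (𝓞 E) E e)⁻¹) 0)
  rw [he, P.mul_pt, mul_zero] at h1
  have h2 : P.pt (algebraMap (𝓞 E) E e * (2 * algebraMap (𝓞 E) E e)⁻¹) 0 ∈ P.lattice := by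
    rw [← Submodule.Quotient.mk_eq_zero]
    exact h1.symm
  obtain ⟨x, y, hxy⟩ := P.mem_lattice_iff.1 h2
  obtain ⟨hx, -⟩ := P.pt_injective hxy
  have h3 : 2 * algebraMap (𝓞 E) E x = 1 := by
    rw [← hx]
    field_simp
  have h4 : algebraMap (𝓞 E) E x = algebraMap ℚ E (1 / 2) := by
    rw [map_div₀, map_one, map_ofNat, ← h3]
    field_simp
  have h5 : IsIntegral ℤ (1 / 2 : ℚ) := by
    rw [← isIntegral_algebraMap_iff (algebraMap ℚ E).injective, ← h4]
    exact RingOfIntegers.isIntegral_coe x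
  obtain ⟨m, hm⟩ := IsIntegrallyClosed.isIntegral_iff.1 h5
  have h6 : 2 * m = 1 := by
    rw [eq_intCast] at hm
    have : (2 * m : ℚ) = 1 := by rw [hm]; norm_num
    exact_mod_cast this
  omega

theorem I_smul_pt_zero (y : E) : Complex.I • P.pt 0 y = -(P.v * canonicalEmbedding E y) := by
  simp only [pt, map_zero, zero_add, smul_smul, Complex.I_mul_I, neg_one_smul]

theorem v_mul_eq_sum (x : E) : P.v * canonicalEmbedding E x =
    ∑ k, P.vc k • P.pt (integralBasis E k * x) 0 := by
  simp [v, Finset.sum_mul, pt]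

theorem I_smul_eq_sum (x : E) : Complex.I • canonicalEmbedding E x =
    ∑ k, P.wc k • P.pt 0 (integralBasis E k * x) := by
  have h1 : Complex.I • canonicalEmbedding E x =
      Complex.I • (P.v * (P.w * canonicalEmbedding E x)) := by
    rw [← mul_assoc, v_mul_w, one_mul]
  rw [h1]
  simp only [w, Finset.sum_mul, Finset.mul_sum, Finset.smul_sum]
  refine Finset.sum_congr rfl fun k _ => ?_
  rw [pt, map_zero, zero_add, map_mul, smul_mul_assoc, mul_smul_comm, smul_comm]

/-- A complex-linear map that preserves the lattice is the multiplication by an algebraic integer.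
Both sides of `A (i ⬝ i v) = i A (i v)` are real combinations of points of `E + i v E` with
coefficients `vₖ` and `wₖ`, and these coefficients are linearly independent over `ℚ`. -/
theorem exists_eq_mul (A : EmbSpace E →ₗ[ℂ] EmbSpace E) (hA : ∀ z ∈ P.lattice, A z ∈ P.lattice) :
    ∃ e : 𝓞 E, ∀ z, A z = canonicalEmbedding E (algebraMap (𝓞 E) E e) * z := by
  have hA' : ∀ x y : 𝓞 E, ∃ x' y' : 𝓞 E, A (P.pt (algebraMap (𝓞 E) E x) (algebraMap (𝓞 E) E y)) =
      P.pt (algebraMap (𝓞 E) E x') (algebraMap (𝓞 E) E y') := fun x y =>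
    P.mem_lattice_iff.1 (hA _ (P.mem_lattice_iff.2 ⟨x, y, rfl⟩))
  obtain ⟨d, e, he⟩ := hA' 0 1
  choose a b hab using fun k => hA' (RingOfIntegers.basis E k) 0
  simp only [map_zero, map_one, ← integralBasis_apply] at he hab
  have h1 : A (Complex.I • P.pt 0 1) = Complex.I • A (P.pt 0 1) := map_smul _ _ _
  have h2 : A (Complex.I • P.pt 0 1) =
      -∑ k, P.vc k • P.pt (algebraMap (𝓞 E) E (a k)) (algebraMap (𝓞 E) E (b k)) := by
    rw [I_smul_pt_zero, v_mul_eq_sum, map_neg, map_sum]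
    congr 1
    refine Finset.sum_congr rfl fun k _ => ?_
    rw [mul_one, ← hab, ← Complex.coe_smul, map_smul, Complex.coe_smul]
  have h3 : Complex.I • A (P.pt 0 1) =
      ∑ k, P.wc k • P.pt 0 (integralBasis E k * algebraMap (𝓞 E) E d) -
        ∑ k, P.vc k • P.pt (integralBasis E k * algebraMap (𝓞 E) E e) 0 := by
    rw [he, ← v_mul_eq_sum, ← I_smul_eq_sum, ← add_zero (algebraMap (𝓞 E) E d),
      ← zero_add (algebraMap (𝓞 E) E e), pt_add, smul_add, I_smul_pt_zero]
    simp [pt, sub_eq_add_neg]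
  have h4 : ∑ k, P.vc k • P.pt
        (algebraMap (𝓞 E) E (a k) + -(integralBasis E k * algebraMap (𝓞 E) E e))
        (algebraMap (𝓞 E) E (b k) + 0) +
      ∑ k, P.wc k • P.pt 0 (integralBasis E k * algebraMap (𝓞 E) E d) = 0 := by
    rw [h2, h3] at h1
    have h5 : ∀ k, P.pt (-(integralBasis E k * algebraMap (𝓞 E) E e)) 0 =
        -P.pt (integralBasis E k * algebraMap (𝓞 E) E e) 0 := fun k => by
      rw [← pt_neg, neg_zero]
    simp only [pt_add, smul_add, Finset.sum_add_distrib, h5, smul_neg, Finset.sum_neg_distrib]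
    rw [← sub_eq_zero] at h1
    rw [← neg_eq_zero, ← h1]
    abel
  obtain ⟨h5, h6, -, -⟩ := P.pt_eq_zero_of_sum_eq_zero h4
  refine ⟨e, fun z => ?_⟩
  have h7 : A = mulMap (algebraMap (𝓞 E) E e) := by
    refine (canonicalEmbedding.latticeBasis E).ext fun k => ?_
    have h8 : canonicalEmbedding E (integralBasis E k) = P.pt (integralBasis E k) 0 := by simp [pt]
    have h9 := congrFun h5 k
    have h10 := congrFun h6 k
    simp only [Pi.zero_apply, add_zero] at h9 h10
    rw [canonicalEmbedding.latticeBasis_apply, h8, hab, h10, add_neg_eq_zero.1 h9]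
    change _ = canonicalEmbedding E (algebraMap (𝓞 E) E e) * P.pt _ _
    rw [P.mul_pt, mul_zero, mul_comm]
  rw [h7]
  rfl

theorem intAction_surjective : Function.Surjective P.intAction := by
  intro f
  obtain ⟨A, hA⟩ := P.torus.exists_linear_lift f.2
  obtain ⟨e, he⟩ := P.exists_eq_mul A (by
    intro z hz
    have h1 := hA z
    have h2 : P.torus.proj z = 0 := (Submodule.Quotient.mk_eq_zero P.lattice).2 hz
    rw [h2, map_zero] at h1
    exact (Submodule.Quotient.mk_eq_zero P.lattice).1 h1)
  refine ⟨e, ?_⟩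
  ext z
  obtain ⟨z, rfl⟩ := Submodule.mkQ_surjective _ z
  refine Eq.trans ?_ (hA z)
  exact congrArg P.torus.proj (he z).symm

/-- The endomorphism ring of the torus is the ring of integers of `E`. -/
noncomputable def endRingEquiv : 𝓞 E ≃+* P.torus.endRing :=
  RingEquiv.ofBijective P.intAction ⟨P.intAction_injective, P.intAction_surjective⟩

variable (E) in
/-- The field `E` is the rationalization of its ring of integers. -/
theorem nonempty_rat_tensor_ringOfIntegers : Nonempty (ℚ ⊗[ℤ] 𝓞 E ≃ₐ[ℚ] E) := by
  let F : ℚ ⊗[ℤ] 𝓞 E →ₐ[ℚ] E := Algebra.TensorProduct.lift (Algebra.ofId ℚ E)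
    (IsScalarTower.toAlgHom ℤ (𝓞 E) E) fun _ _ => mul_comm _ _
  have hsurj : Function.Surjective F := by
    intro x
    have halg : IsAlgebraic ℤ x := (IsFractionRing.isAlgebraic_iff ℤ ℚ E).2
      (Algebra.IsAlgebraic.isAlgebraic x)
    obtain ⟨n, hn, hx⟩ := halg.exists_integral_multiple
    obtain ⟨y, hy⟩ : ∃ y : 𝓞 E, algebraMap (𝓞 E) E y = n • x := ⟨⟨n • x, hx⟩, rfl⟩
    refine ⟨((n : ℚ)⁻¹) ⊗ₜ y, ?_⟩
    refine (Algebra.TensorProduct.lift_tmul _ _ _ _ _).trans ?_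
    change algebraMap ℚ E (n : ℚ)⁻¹ * algebraMap (𝓞 E) E y = x
    rw [hy]
    have : (n : E) ≠ 0 := by exact_mod_cast hn
    rw [map_inv₀, map_intCast, zsmul_eq_mul, inv_mul_cancel_left₀ this]
  have hdim : finrank ℚ (ℚ ⊗[ℤ] 𝓞 E) = finrank ℚ E := by
    rw [Module.finrank_baseChange, RingOfIntegers.rank]
  have hinj : Function.Injective F.toLinearMap :=
    (LinearMap.injective_iff_surjective_of_finrank_eq_finrank hdim).2 hsurj
  exact ⟨AlgEquiv.ofBijective F ⟨hinj, hsurj⟩⟩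

theorem nonempty_endAlg : Nonempty (P.torus.endAlg ≃ₐ[ℚ] E) := by
  obtain ⟨e⟩ := nonempty_rat_tensor_ringOfIntegers E
  exact ⟨(Algebra.TensorProduct.congr AlgEquiv.refl P.endRingEquiv.symm.toIntAlgEquiv).trans e⟩

end GenericUnit

/-! ### Alternating forms of degree two -/

section Forms

variable {V : Type*} [AddCommGroup V] [Module ℂ V]

/-- The alternating form of a bilinear form that vanishes on the diagonal. -/
noncomputable def altOfBilin (B : V →ₗ[ℝ] V →ₗ[ℝ] ℂ) (hB : ∀ z, B z z = 0) :
    V [⋀^Fin 2]→ₗ[ℝ] ℂ where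
  toFun m := B (m 0) (m 1)
  map_update_add' m i x y := by fin_cases i <;> simp
  map_update_smul' m i c x := by fin_cases i <;> simp
  map_eq_zero_of_eq' m i j hij hne := by
    fin_cases i <;> fin_cases j <;> simp_all

theorem form_swap (ω : V [⋀^Fin 2]→ₗ[ℝ] ℂ) (z z' : V) : ω ![z', z] = -ω ![z, z'] := by
  have := ω.map_swap ![z, z'] (i := 0) (j := 1) (by decide)
  rw [← this]
  congr 1
  ext i
  fin_cases i <;> simp

/-- An alternating form as a bilinear map. -/
noncomputable def formBilin (ω : V [⋀^Fin 2]→ₗ[ℝ] ℂ) : V →ₗ[ℝ] V →ₗ[ℝ] ℂ :=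
  LinearMap.mk₂ ℝ (fun z z' => ω ![z, z'])
    (fun x y z => ω.map_vecCons_add ![z] x y)
    (fun c x z => ω.map_vecCons_smul ![z] c x)
    (fun z x y => by
      rw [form_swap ω (x + y) z, form_swap ω x z, form_swap ω y z, ω.map_vecCons_add ![z] x y,
        neg_add])
    (fun c z x => by
      rw [form_swap ω (c • x) z, form_swap ω x z, ω.map_vecCons_smul ![z] c x, smul_neg])

theorem formBilin_apply (ω : V [⋀^Fin 2]→ₗ[ℝ] ℂ) (z z' : V) : formBilin ω z z' = ω ![z, z'] := rfl

/-- The action of an endomorphism as a derivation on alternating forms. -/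
noncomputable def formDeriv (X : V →ₗ[ℝ] V) (ω : V [⋀^Fin 2]→ₗ[ℝ] ℂ) : V [⋀^Fin 2]→ₗ[ℝ] ℂ :=
  altOfBilin (formBilin ω ∘ₗ X + (formBilin ω).compl₂ X) fun z => by
    simp only [LinearMap.add_apply, LinearMap.comp_apply, LinearMap.compl₂_apply, formBilin_apply]
    rw [form_swap ω z, neg_add_cancel]

theorem formDeriv_apply (X : V →ₗ[ℝ] V) (ω : V [⋀^Fin 2]→ₗ[ℝ] ℂ) (z z' : V) :
    formDeriv X ω ![z, z'] = ω ![X z, z'] + ω ![z, X z'] := rfl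

theorem formDeriv_eq (X : V →ₗ[ℝ] V) (ω : V [⋀^Fin 2]→ₗ[ℝ] ℂ) (z z' : V) :
    formDeriv X ω ![z, z'] = formBilin ω (X z) z' + formBilin ω z (X z') := rfl

theorem form_sum_apply {ι : Type*} (s : Finset ι) (ω : ι → V [⋀^Fin 2]→ₗ[ℝ] ℂ) (z z' : V) :
    (∑ k ∈ s, ω k) ![z, z'] = ∑ k ∈ s, ω k ![z, z'] :=
  map_sum (⟨⟨fun ω => ω ![z, z'], rfl⟩, fun _ _ => rfl⟩ : V [⋀^Fin 2]→ₗ[ℝ] ℂ →+ ℂ) ω s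

theorem form_ext {ω ω' : V [⋀^Fin 2]→ₗ[ℝ] ℂ} (h : ∀ z z', ω ![z, z'] = ω' ![z, z']) : ω = ω' := by
  ext m
  have : m = ![m 0, m 1] := by ext i; fin_cases i <;> rfl
  rw [this, h]

theorem formDeriv_add (X Y : V →ₗ[ℝ] V) (ω : V [⋀^Fin 2]→ₗ[ℝ] ℂ) :
    formDeriv (X + Y) ω = formDeriv X ω + formDeriv Y ω := by
  refine form_ext fun z z' => ?_
  simp only [AlternatingMap.add_apply, formDeriv_eq, LinearMap.add_apply, map_add]
  ring

theorem formDeriv_smul (c : ℝ) (X : V →ₗ[ℝ] V) (ω : V [⋀^Fin 2]→ₗ[ℝ] ℂ) :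
    formDeriv (c • X) ω = c • formDeriv X ω := by
  refine form_ext fun z z' => ?_
  simp only [AlternatingMap.smul_apply, formDeriv_eq, LinearMap.smul_apply, map_smul, smul_add]

theorem formDeriv_sum {ι : Type*} (s : Finset ι) (X : ι → V →ₗ[ℝ] V)
    (ω : V [⋀^Fin 2]→ₗ[ℝ] ℂ) :
    formDeriv (∑ k ∈ s, X k) ω = ∑ k ∈ s, formDeriv (X k) ω :=
  map_sum (⟨⟨fun X => formDeriv X ω, by simpa using formDeriv_smul 0 0 ω⟩,
    fun X Y => formDeriv_add X Y ω⟩ : (V →ₗ[ℝ] V) →+ V [⋀^Fin 2]→ₗ[ℝ] ℂ) X s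

/-- The form `(z, z') ↦ β (S z) (T z') - β (S z') (T z)`. -/
noncomputable def wedge (β : V →ₗ[ℂ] V →ₗ[ℂ] ℂ) (S T : V →ₗ[ℝ] V) : V [⋀^Fin 2]→ₗ[ℝ] ℂ :=
  altOfBilin (LinearMap.mk₂ ℝ (fun z z' => β (S z) (T z') - β (S z') (T z))
    (fun x y z => by simp only [map_add, LinearMap.add_apply]; ring)
    (fun c x z => by
      rw [S.map_smul, T.map_smul, ← Complex.coe_smul c (S _), ← Complex.coe_smul c (T _), map_smul,
        map_smul, LinearMap.smul_apply, ← smul_sub, Complex.coe_smul])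
    (fun x y z => by simp only [map_add, LinearMap.add_apply]; ring)
    (fun c x z => by
      rw [S.map_smul, T.map_smul, ← Complex.coe_smul c (S _), ← Complex.coe_smul c (T _), map_smul,
        map_smul, LinearMap.smul_apply, ← smul_sub, Complex.coe_smul]))
    fun z => by simp

theorem wedge_apply (β : V →ₗ[ℂ] V →ₗ[ℂ] ℂ) (S T : V →ₗ[ℝ] V) (z z' : V) :
    wedge β S T ![z, z'] = β (S z) (T z') - β (S z') (T z) := rfl

theorem wedge_add (β γ : V →ₗ[ℂ] V →ₗ[ℂ] ℂ) (S T : V →ₗ[ℝ] V) :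
    wedge (β + γ) S T = wedge β S T + wedge γ S T := by
  refine form_ext fun z z' => ?_
  simp only [AlternatingMap.add_apply, wedge_apply, LinearMap.add_apply]
  ring

theorem wedge_smul (c : ℂ) (β : V →ₗ[ℂ] V →ₗ[ℂ] ℂ) (S T : V →ₗ[ℝ] V) :
    wedge (c • β) S T = c • wedge β S T := by
  refine form_ext fun z z' => ?_
  simp only [AlternatingMap.smul_apply, wedge_apply, LinearMap.smul_apply, smul_sub]

theorem wedge_sum {ι : Type*} (s : Finset ι) (β : ι → V →ₗ[ℂ] V →ₗ[ℂ] ℂ) (S T : V →ₗ[ℝ] V) :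
    wedge (∑ k ∈ s, β k) S T = ∑ k ∈ s, wedge (β k) S T :=
  map_sum (⟨⟨fun β => wedge β S T, by simpa using wedge_smul 0 0 S T⟩,
    fun β γ => wedge_add β γ S T⟩ : (V →ₗ[ℂ] V →ₗ[ℂ] ℂ) →+ V [⋀^Fin 2]→ₗ[ℝ] ℂ) β s

/-- The complex-bilinear map of a form of type `(2, 0)`. -/
theorem exists_bilin_of_holomorphic {ω : V [⋀^Fin 2]→ₗ[ℝ] ℂ}
    (h : ∀ z z', ω ![Complex.I • z, z'] = Complex.I * ω ![z, z']) :
    ∃ β : V →ₗ[ℂ] V →ₗ[ℂ] ℂ, ∀ z z', β z z' = ω ![z, z'] := by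
  have hsmul : ∀ (c : ℂ) (z z' : V), ω ![c • z, z'] = c • ω ![z, z'] := by
    intro c z z'
    have h1 : c • z = c.re • z + c.im • (Complex.I • z) := by
      rw [← Complex.coe_smul, ← Complex.coe_smul, smul_smul, ← add_smul, Complex.re_add_im]
    rw [h1, ← formBilin_apply, map_add, map_smul, map_smul, LinearMap.add_apply,
      LinearMap.smul_apply, LinearMap.smul_apply, formBilin_apply, formBilin_apply, h,
      Complex.real_smul, Complex.real_smul, smul_eq_mul]
    conv_rhs => rw [← Complex.re_add_im c]
    ring
  refine ⟨LinearMap.mk₂ ℂ (fun z z' => ω ![z, z']) (fun x y z => ω.map_vecCons_add ![z] x y)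
    hsmul (fun z x y => (formBilin ω z).map_add x y) (fun c z x => ?_), fun z z' => rfl⟩
  rw [form_swap ω (c • x) z, hsmul, form_swap ω x z, smul_neg]

/-- If a combination of rational forms whose coefficients are linearly independent over `ℚ` lies in
the complexification of a rational space `H` of forms, then each of these forms lies in `H`. The
forms are extracted by `ℚ`-linear functionals `ℂ → ℚ`, which map the values of an element of the
complexification to the values of an element of `H`. -/
theorem mem_of_sum_smul_mem_span (Λ : Set V)
    (hΛ : ∀ ω ω' : V [⋀^Fin 2]→ₗ[ℝ] ℂ,
      (∀ z ∈ Λ, ∀ z' ∈ Λ, ω ![z, z'] = ω' ![z, z']) → ω = ω')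
    (H : Submodule ℚ (V [⋀^Fin 2]→ₗ[ℝ] ℂ))
    (hH : ∀ ω ∈ H, ∀ z ∈ Λ, ∀ z' ∈ Λ, ∃ q : ℚ, ω ![z, z'] = q)
    {J : Type*} [Fintype J] {r : J → ℝ} (hr : LinearIndependent ℚ r)
    {η : J → V [⋀^Fin 2]→ₗ[ℝ] ℂ} (hη : ∀ j, ∀ z ∈ Λ, ∀ z' ∈ Λ, ∃ q : ℚ, η j ![z, z'] = q)
    (hmem : ∑ j, r j • η j ∈ Submodule.span ℂ (H : Set (V [⋀^Fin 2]→ₗ[ℝ] ℂ))) (j : J) :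
    η j ∈ H := by
  classical
  have hrC : LinearIndependent ℚ fun j => (r j : ℂ) := by
    have h1 := hr.map' ((Complex.ofRealAm : ℝ →ₗ[ℝ] ℂ).restrictScalars ℚ)
      (LinearMap.ker_eq_bot.2 Complex.ofReal_injective)
    exact h1
  obtain ⟨π, hπ⟩ := ((Finsupp.lapply j : (J →₀ ℚ) →ₗ[ℚ] ℚ) ∘ₗ hrC.repr).exists_extend
  have hπr : ∀ i, π (r i : ℂ) = if i = j then 1 else 0 := by
    intro i
    have h1 := LinearMap.congr_fun hπ ⟨(r i : ℂ), Submodule.subset_span ⟨i, rfl⟩⟩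
    simp only [LinearMap.comp_apply, Submodule.subtype_apply] at h1
    rw [h1, hrC.repr_eq_single i _ rfl, Finsupp.lapply_apply, Finsupp.single_apply]
  have hπq : ∀ (c : ℂ) (q : ℚ), π (c * q) = π c * q := by
    intro c q
    have : c * q = q • c := by rw [Rat.smul_def, mul_comm]
    rw [this, map_smul, smul_eq_mul, mul_comm]
  have key : ∀ ω ∈ Submodule.span ℂ (H : Set (V [⋀^Fin 2]→ₗ[ℝ] ℂ)), ∀ c : ℂ,
      ∃ h ∈ H, ∀ z ∈ Λ, ∀ z' ∈ Λ, ((π (c * ω ![z, z']) : ℚ) : ℂ) = h ![z, z'] := by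
    intro ω hω
    induction hω using Submodule.span_induction with
    | mem h hh =>
      intro c
      refine ⟨π c • h, H.smul_mem _ hh, fun z hz z' hz' => ?_⟩
      obtain ⟨q, hq⟩ := hH h hh z hz z' hz'
      rw [hq, hπq, AlternatingMap.smul_apply, hq, Rat.smul_def, Rat.cast_mul]
    | zero => exact fun c => ⟨0, H.zero_mem, fun z _ z' _ => by simp⟩
    | add ω ω' _ _ ih ih' =>
      intro c
      obtain ⟨h, hh, e⟩ := ih c
      obtain ⟨h', hh', e'⟩ := ih' c
      refine ⟨h + h', H.add_mem hh hh', fun z hz z' hz' => ?_⟩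
      rw [AlternatingMap.add_apply, AlternatingMap.add_apply, mul_add, map_add, Rat.cast_add,
        e z hz z' hz', e' z hz z' hz']
    | smul a ω _ ih =>
      intro c
      obtain ⟨h, hh, e⟩ := ih (c * a)
      refine ⟨h, hh, fun z hz z' hz' => ?_⟩
      rw [AlternatingMap.smul_apply, smul_eq_mul, ← mul_assoc, e z hz z' hz']
  obtain ⟨h, hh, e⟩ := key _ hmem 1
  have : η j = h := by
    refine hΛ _ _ fun z hz z' hz' => ?_
    choose q hq using fun j => hη j z hz z' hz'
    rw [← e z hz z' hz', form_sum_apply, one_mul, map_sum]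
    simp only [AlternatingMap.smul_apply, hq, Complex.real_smul, hπq, hπr]
    simp
  rw [this]
  exact hh

end Forms

/-! ### The operators of `𝔰𝔩₂(E)` -/

namespace GenericUnit

open NumberField Module

section Operators

variable {E : Type} [Field E] [NumberField E]

/-- The complex-bilinear extension to `E ⊗ ℂ` of a rational functional on `E ⊗ E`. -/
noncomputable def bilinExt (φ : Dual ℚ (E ⊗[ℚ] E)) : EmbSpace E →ₗ[ℂ] EmbSpace E →ₗ[ℂ] ℂ :=
  (canonicalEmbedding.latticeBasis E).constr ℂ fun k =>
    (canonicalEmbedding.latticeBasis E).constr ℂ fun l =>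
      (φ (integralBasis E k ⊗ₜ integralBasis E l) : ℂ)

theorem bilinExt_apply (φ : Dual ℚ (E ⊗[ℚ] E)) (x y : E) :
    bilinExt φ (canonicalEmbedding E x) (canonicalEmbedding E y) = φ (x ⊗ₜ y) := by
  let B₁ : E →ₗ[ℚ] E →ₗ[ℚ] ℂ := LinearMap.mk₂ ℚ
    (fun x y => bilinExt φ (canonicalEmbedding E x) (canonicalEmbedding E y))
    (fun x y z => by rw [map_add, map_add, LinearMap.add_apply])
    (fun c x z => by rw [map_rat_smul, map_rat_smul]; rfl)
    (fun x y z => by rw [map_add, map_add])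
    (fun c x z => by rw [map_rat_smul, map_rat_smul])
  let B₂ : E →ₗ[ℚ] E →ₗ[ℚ] ℂ := LinearMap.mk₂ ℚ (fun x y => ((φ (x ⊗ₜ y) : ℚ) : ℂ))
    (fun x y z => by rw [TensorProduct.add_tmul, map_add, Rat.cast_add])
    (fun c x z => by
      rw [← TensorProduct.smul_tmul', map_smul, smul_eq_mul, Rat.cast_mul, Rat.smul_def])
    (fun x y z => by rw [TensorProduct.tmul_add, map_add, Rat.cast_add])
    (fun c x z => by
      rw [TensorProduct.tmul_smul, map_smul, smul_eq_mul, Rat.cast_mul, Rat.smul_def])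
  have : B₁ = B₂ := by
    refine LinearMap.ext_basis (integralBasis E) (integralBasis E) fun k l => ?_
    simp only [B₁, B₂, LinearMap.mk₂_apply, bilinExt]
    rw [← canonicalEmbedding.latticeBasis_apply, ← canonicalEmbedding.latticeBasis_apply,
      Basis.constr_basis, Basis.constr_basis]
  exact LinearMap.congr_fun₂ this x y

theorem bilinExt_add (φ φ' : Dual ℚ (E ⊗[ℚ] E)) :
    bilinExt (φ + φ') = bilinExt φ + bilinExt φ' := by
  refine LinearMap.ext_basis (canonicalEmbedding.latticeBasis E)
    (canonicalEmbedding.latticeBasis E) fun k l => ?_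
  simp only [LinearMap.add_apply, canonicalEmbedding.latticeBasis_apply, bilinExt_apply,
    Rat.cast_add]

/-- Every antisymmetric complex-bilinear form on `E ⊗ ℂ` is a complex combination of extensions of
antisymmetric rational forms. -/
theorem exists_eq_sum_bilinExt (β : EmbSpace E →ₗ[ℂ] EmbSpace E →ₗ[ℂ] ℂ)
    (hβ : ∀ z z', β z' z = -β z z') :
    ∃ (J : Type) (_ : Fintype J) (c : J → ℂ) (φ : J → Dual ℚ (E ⊗[ℚ] E)),
      (∀ j z, φ j (tensorSwap E z) = -φ j z) ∧ β = ∑ j, c j • bilinExt (φ j) := by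
  classical
  let b := integralBasis E
  let t := b.tensorProduct b
  refine ⟨Free.ChooseBasisIndex ℤ (𝓞 E) × Free.ChooseBasisIndex ℤ (𝓞 E), inferInstance,
    fun j => (1 / 2) * β (canonicalEmbedding E (b j.1)) (canonicalEmbedding E (b j.2)),
    fun j => t.coord j - t.coord j.swap, ?_, ?_⟩
  · intro j z
    induction z with
    | zero => simp
    | add z z' hz hz' => rw [map_add, map_add, map_add, hz, hz']; ring
    | tmul x y =>
      obtain ⟨j₁, j₂⟩ := j
      simp only [LinearMap.sub_apply, Basis.coord_apply, Algebra.TensorProduct.comm_tmul,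
        Prod.swap_prod_mk, t, Basis.tensorProduct_repr_tmul_apply, smul_eq_mul]
      ring
  · refine LinearMap.ext_basis (canonicalEmbedding.latticeBasis E)
      (canonicalEmbedding.latticeBasis E) fun k l => ?_
    have hval : ∀ j : Free.ChooseBasisIndex ℤ (𝓞 E) × Free.ChooseBasisIndex ℤ (𝓞 E),
        (t.coord j - t.coord j.swap) (b k ⊗ₜ b l) =
          (if j = (k, l) then 1 else 0) - (if j = (l, k) then 1 else 0) := by
      intro j
      have h1 : b k ⊗ₜ[ℚ] b l = t (k, l) := (Basis.tensorProduct_apply b b k l).symm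
      rw [LinearMap.sub_apply, h1, Basis.coord_apply, Basis.coord_apply, Basis.repr_self,
        Finsupp.single_apply, Finsupp.single_apply]
      congr 1
      · simp [eq_comm]
      · obtain ⟨j₁, j₂⟩ := j
        simp [Prod.ext_iff, eq_comm, and_comm]
    rw [LinearMap.sum_apply, LinearMap.sum_apply, canonicalEmbedding.latticeBasis_apply,
      canonicalEmbedding.latticeBasis_apply]
    simp only [LinearMap.smul_apply, bilinExt_apply, smul_eq_mul]
    change _ = ∑ j, _ * (((t.coord j - t.coord j.swap) (b k ⊗ₜ b l) : ℚ) : ℂ)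
    simp only [hval]
    simp only [Rat.cast_sub, apply_ite (Rat.cast : ℚ → ℂ), Rat.cast_one, Rat.cast_zero, mul_sub,
      Finset.sum_sub_distrib, mul_ite, mul_one, mul_zero]
    rw [Finset.sum_ite_eq', Finset.sum_ite_eq', if_pos (Finset.mem_univ _),
      if_pos (Finset.mem_univ _), hβ (canonicalEmbedding E (b k)) (canonicalEmbedding E (b l))]
    ring

variable (P : GenericUnit E)

/-- The real-linear map `a + i v b ↦ x b` of `E ⊗ ℂ`. -/
noncomputable def raise (x : E) : EmbSpace E →ₗ[ℝ] EmbSpace E :=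
  LinearMap.mulLeft ℝ (canonicalEmbedding E x) ∘ₗ P.snd

/-- The real-linear map `a + i v b ↦ i v x a` of `E ⊗ ℂ`. -/
noncomputable def lower (x : E) : EmbSpace E →ₗ[ℝ] EmbSpace E :=
  LinearMap.mulLeft ℝ (Complex.I • (P.v * canonicalEmbedding E x)) ∘ₗ fst

@[simp]
theorem raise_pt (x a b : E) : P.raise x (P.pt a b) = P.pt (x * b) 0 := by
  change canonicalEmbedding E x * P.snd (P.pt a b) = _
  rw [snd_pt]
  simp [pt]

@[simp]
theorem lower_pt (x a b : E) : P.lower x (P.pt a b) = P.pt 0 (x * a) := by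
  change Complex.I • (P.v * canonicalEmbedding E x) * fst (P.pt a b) = _
  rw [fst_pt]
  simp [pt, mul_assoc]

/-- The real-linear map `z ↦ x * fst z`. -/
noncomputable def mulFst (x : E) : EmbSpace E →ₗ[ℝ] EmbSpace E :=
  LinearMap.mulLeft ℝ (canonicalEmbedding E x) ∘ₗ fst

@[simp]
theorem mulFst_pt (x a b : E) : mulFst x (P.pt a b) = canonicalEmbedding E (x * a) := by
  change canonicalEmbedding E x * fst (P.pt a b) = _
  simp

theorem raise_pt_eq_canonicalEmbedding (x a b : E) :
    P.raise x (P.pt a b) = canonicalEmbedding E (x * b) := by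
  rw [raise_pt]
  simp [pt]

theorem form_ext_lattice {ω ω' : EmbSpace E [⋀^Fin 2]→ₗ[ℝ] ℂ}
    (h : ∀ z ∈ P.lattice, ∀ z' ∈ P.lattice, ω ![z, z'] = ω' ![z, z']) : ω = ω' := by
  refine Basis.ext_alternating P.realBasis fun m _ => ?_
  have : (fun i => P.realBasis (m i)) = ![P.realBasis (m 0), P.realBasis (m 1)] := by
    ext i : 1; fin_cases i <;> rfl
  rw [this]
  exact h _ (Submodule.subset_span ⟨_, rfl⟩) _ (Submodule.subset_span ⟨_, rfl⟩)

theorem form_ext_pt {ω ω' : EmbSpace E [⋀^Fin 2]→ₗ[ℝ] ℂ}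
    (h : ∀ a b a' b' : E, ω ![P.pt a b, P.pt a' b'] = ω' ![P.pt a b, P.pt a' b']) : ω = ω' := by
  refine P.form_ext_lattice fun z hz z' hz' => ?_
  obtain ⟨a, b, rfl⟩ := P.mem_lattice_iff.1 hz
  obtain ⟨a', b', rfl⟩ := P.mem_lattice_iff.1 hz'
  exact h _ _ _ _

theorem raise_mem (x : 𝓞 E) {z : EmbSpace E} (hz : z ∈ P.lattice) :
    P.raise (algebraMap (𝓞 E) E x) z ∈ P.lattice := by
  obtain ⟨a, b, rfl⟩ := P.mem_lattice_iff.1 hz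
  exact P.mem_lattice_iff.2 ⟨x * b, 0, by rw [raise_pt, map_mul, map_zero]⟩

theorem lower_mem (x : 𝓞 E) {z : EmbSpace E} (hz : z ∈ P.lattice) :
    P.lower (algebraMap (𝓞 E) E x) z ∈ P.lattice := by
  obtain ⟨a, b, rfl⟩ := P.mem_lattice_iff.1 hz
  exact P.mem_lattice_iff.2 ⟨0, x * a, by rw [lower_pt, map_mul, map_zero]⟩

/-- The multiplication by `i` in terms of the operators of `𝔰𝔩₂(E)`, with coefficients that are
linearly independent over `ℚ`. -/
theorem I_smul_eq_sum_lower_raise :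
    (Complex.I • LinearMap.id : EmbSpace E →ₗ[ℝ] EmbSpace E) =
      ∑ k, P.wc k • P.lower (integralBasis E k) + ∑ k, P.vc k • -P.raise (integralBasis E k) := by
  refine P.realBasis.ext fun j => ?_
  obtain ⟨a, b, hj⟩ : ∃ a b : E, P.realBasis j = P.pt a b := by
    rcases j with k | k
    · exact ⟨_, _, P.realBasis_inl k⟩
    · exact ⟨_, _, P.realBasis_inr k⟩
  simp only [hj, LinearMap.add_apply, LinearMap.sum_apply, LinearMap.smul_apply,
    LinearMap.neg_apply, lower_pt, raise_pt, LinearMap.id_apply, smul_neg,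
    Finset.sum_neg_distrib, ← I_smul_eq_sum, ← v_mul_eq_sum]
  rw [← add_zero a, ← zero_add b, pt_add, smul_add, I_smul_pt_zero]
  simp [pt]

end Operators

end GenericUnit

/-! ### Hodge substructures of the torus -/

/-- Multiplication by `i` acts on the Hodge components as a derivation with the eigenvalues `2 i`,
`0` and `-2 i`, hence it preserves the complexification of a Hodge substructure. -/
theorem ComplexTorus.IsHodgeSubstructure.formDeriv_I_mem {T : ComplexTorus}
    {H : Submodule ℚ T.H2C} (hH : T.IsHodgeSubstructure H) {h : T.H2C} (hh : h ∈ T.complexify H) :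
    formDeriv (Complex.I • LinearMap.id : T.V →ₗ[ℝ] T.V) h ∈ T.complexify H := by
  rw [hH.2] at hh
  obtain ⟨h', hh', h₃, ⟨hh₃, hh₃'⟩, rfl⟩ := Submodule.mem_sup.1 hh
  obtain ⟨h₁, ⟨hh₁, hh₁'⟩, h₂, ⟨hh₂, hh₂'⟩, rfl⟩ := Submodule.mem_sup.1 hh'
  have e : formDeriv (Complex.I • LinearMap.id : T.V →ₗ[ℝ] T.V) (h₁ + h₂ + h₃) =
      (2 * Complex.I) • h₁ - (2 * Complex.I) • h₃ := by
    refine form_ext fun z z' => ?_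
    have e₁ : ∀ z z', h₁ ![Complex.I • z, z'] = Complex.I * h₁ ![z, z'] := hh₁'
    have e₂ : ∀ z z', h₂ ![Complex.I • z, Complex.I • z'] = h₂ ![z, z'] := hh₂'
    have e₃ : ∀ z z', h₃ ![Complex.I • z, z'] = -Complex.I * h₃ ![z, z'] := hh₃'
    have e₁' : h₁ ![z, Complex.I • z'] = Complex.I * h₁ ![z, z'] := by
      rw [form_swap h₁ (Complex.I • z') z, e₁, form_swap h₁ z z']
      ring
    have e₃' : h₃ ![z, Complex.I • z'] = -Complex.I * h₃ ![z, z'] := by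
      rw [form_swap h₃ (Complex.I • z') z, e₃, form_swap h₃ z z']
      ring
    have e₂' : h₂ ![z, Complex.I • z'] = -h₂ ![Complex.I • z, z'] := by
      rw [← e₂ z (Complex.I • z'), smul_smul, Complex.I_mul_I, neg_one_smul, ← formBilin_apply,
        map_neg, formBilin_apply]
    rw [formDeriv_apply]
    simp only [AlternatingMap.add_apply, AlternatingMap.sub_apply, AlternatingMap.smul_apply,
      LinearMap.smul_apply, LinearMap.id_apply, smul_eq_mul, e₁, e₁', e₂', e₃, e₃']
    ring
  rw [e]
  exact (T.complexify H).sub_mem ((T.complexify H).smul_mem _ hh₁)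
    ((T.complexify H).smul_mem _ hh₃)

namespace GenericUnit

open NumberField Module

section HodgeStructures

variable {E : Type} [Field E] [NumberField E] (P : GenericUnit E)

/-- The restriction to `E ⊗ E` of a form that is rational on the lattice. -/
theorem exists_restriction {h : EmbSpace E [⋀^Fin 2]→ₗ[ℝ] ℂ}
    (hh : ∀ z ∈ P.lattice, ∀ z' ∈ P.lattice, ∃ q : ℚ, h ![z, z'] = q) :
    ∃ φ : Dual ℚ (E ⊗[ℚ] E), (∀ z, φ (tensorSwap E z) = -φ z) ∧
      ∀ x y, h ![P.pt x 0, P.pt y 0] = φ (x ⊗ₜ y) := by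
  have hω : ∀ k, P.pt (integralBasis E k) 0 ∈ P.lattice := fun k =>
    Submodule.subset_span ⟨.inl k, P.realBasis_inl k⟩
  choose q hq using fun k l => hh _ (hω k) _ (hω l)
  let b := integralBasis E
  let t := b.tensorProduct b
  let φ : Dual ℚ (E ⊗[ℚ] E) := t.constr ℚ fun j => q j.1 j.2
  have hpt : ∀ x y : E, P.pt (x + y) 0 = P.pt x 0 + P.pt y 0 := fun x y => by
    rw [← pt_add, add_zero]
  have hpt' : ∀ (c : ℚ) (x : E), P.pt (c • x) 0 = c • P.pt x 0 := fun c x => by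
    simp only [pt, map_rat_smul, map_zero, mul_zero, smul_zero, add_zero]
  let B₁ : E →ₗ[ℚ] E →ₗ[ℚ] ℂ := LinearMap.mk₂ ℚ
    (fun x y => formBilin h (P.pt x 0) (P.pt y 0))
    (fun x y z => by rw [hpt, map_add, LinearMap.add_apply])
    (fun c x z => by rw [hpt', map_rat_smul]; rfl)
    (fun x y z => by rw [hpt, map_add])
    (fun c x z => by rw [hpt', map_rat_smul])
  let B₂ : E →ₗ[ℚ] E →ₗ[ℚ] ℂ := LinearMap.mk₂ ℚ (fun x y => ((φ (x ⊗ₜ y) : ℚ) : ℂ))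
    (fun x y z => by rw [TensorProduct.add_tmul, map_add, Rat.cast_add])
    (fun c x z => by
      rw [← TensorProduct.smul_tmul', map_smul, smul_eq_mul, Rat.cast_mul, Rat.smul_def])
    (fun x y z => by rw [TensorProduct.tmul_add, map_add, Rat.cast_add])
    (fun c x z => by
      rw [TensorProduct.tmul_smul, map_smul, smul_eq_mul, Rat.cast_mul, Rat.smul_def])
  have hB : B₁ = B₂ := by
    refine LinearMap.ext_basis b b fun k l => ?_
    simp only [B₁, B₂, LinearMap.mk₂_apply, formBilin_apply]
    have h1 : b k ⊗ₜ[ℚ] b l = t (k, l) := (Basis.tensorProduct_apply b b k l).symm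
    rw [h1, Basis.constr_basis]
    exact hq k l
  have hval : ∀ x y, h ![P.pt x 0, P.pt y 0] = φ (x ⊗ₜ y) := fun x y => LinearMap.congr_fun₂ hB x y
  refine ⟨φ, fun z => ?_, hval⟩
  induction z with
  | zero => simp
  | add z z' hz hz' => rw [map_add, map_add, map_add, hz, hz']; ring
  | tmul x y =>
    have h1 := form_swap h (P.pt x 0) (P.pt y 0)
    rw [hval, hval] at h1
    rw [Algebra.TensorProduct.comm_tmul]
    exact_mod_cast h1

/-- A rational space of forms that is stable under the algebra `𝔰𝔩₂(E)`. -/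
structure IsStable (H : Submodule ℚ (EmbSpace E [⋀^Fin 2]→ₗ[ℝ] ℂ)) : Prop where
  rational : ∀ h ∈ H, ∀ z ∈ P.lattice, ∀ z' ∈ P.lattice, ∃ q : ℚ, h ![z, z'] = q
  raise : ∀ h ∈ H, ∀ x : E, formDeriv (P.raise x) h ∈ H
  lower : ∀ h ∈ H, ∀ x : E, formDeriv (P.lower x) h ∈ H

/-- A rational space of forms whose complexification is stable under multiplication by `i` is
stable under `𝔰𝔩₂(E)`, because of the choice of the generic unit. -/
theorem isStable_of_I_stable {H : Submodule ℚ (EmbSpace E [⋀^Fin 2]→ₗ[ℝ] ℂ)}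
    (hH : ∀ h ∈ H, ∀ z ∈ P.lattice, ∀ z' ∈ P.lattice, ∃ q : ℚ, h ![z, z'] = q)
    (hI : ∀ h ∈ H, formDeriv (Complex.I • LinearMap.id) h ∈
      Submodule.span ℂ (H : Set (EmbSpace E [⋀^Fin 2]→ₗ[ℝ] ℂ))) :
    P.IsStable H := by
  have hrat : ∀ h ∈ H, ∀ X : EmbSpace E →ₗ[ℝ] EmbSpace E, (∀ z ∈ P.lattice, X z ∈ P.lattice) →
      ∀ z ∈ P.lattice, ∀ z' ∈ P.lattice, ∃ q : ℚ, formDeriv X h ![z, z'] = q := by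
    intro h hh X hX z hz z' hz'
    obtain ⟨q, hq⟩ := hH h hh _ (hX z hz) _ hz'
    obtain ⟨q', hq'⟩ := hH h hh _ hz _ (hX z' hz')
    exact ⟨q + q', by rw [formDeriv_apply, hq, hq', Rat.cast_add]⟩
  -- the operators of `𝔰𝔩₂(E)` that correspond to an integral basis
  have key : ∀ h ∈ H, ∀ k, formDeriv (P.raise (integralBasis E k)) h ∈ H ∧
      formDeriv (P.lower (integralBasis E k)) h ∈ H := by
    intro h hh k
    have hint : ∀ k, integralBasis E k = algebraMap (𝓞 E) E (RingOfIntegers.basis E k) := fun k =>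
      integralBasis_apply E k
    have h1 := mem_of_sum_smul_mem_span (P.lattice : Set (EmbSpace E))
      (fun ω ω' => P.form_ext_lattice) H hH P.linearIndependent
      (η := Sum.elim (fun k => formDeriv (-P.raise (integralBasis E k)) h)
        fun k => formDeriv (P.lower (integralBasis E k)) h) (by
          rintro (k | k)
          · refine hrat h hh _ fun z hz => neg_mem ?_
            rw [hint]
            exact P.raise_mem _ hz
          · refine hrat h hh _ fun z hz => ?_
            rw [hint]
            exact P.lower_mem _ hz) (by
          have h2 := hI h hh
          rw [I_smul_eq_sum_lower_raise, formDeriv_add, formDeriv_sum, formDeriv_sum, add_comm] at h2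
          simpa only [Fintype.sum_sum_type, Sum.elim_inl, Sum.elim_inr, formDeriv_smul] using h2)
    refine ⟨?_, h1 (.inr k)⟩
    have h3 := H.neg_mem (h1 (.inl k))
    have h4 : formDeriv (-P.raise (integralBasis E k)) h =
        -formDeriv (P.raise (integralBasis E k)) h := by
      rw [← neg_one_smul ℝ, formDeriv_smul, neg_one_smul]
    rwa [Sum.elim_inl, h4, neg_neg] at h3
  have hspan : ∀ (h : EmbSpace E [⋀^Fin 2]→ₗ[ℝ] ℂ) (X : E →+ (EmbSpace E →ₗ[ℝ] EmbSpace E)),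
      (∀ k, formDeriv (X (integralBasis E k)) h ∈ H) → ∀ x, formDeriv (X x) h ∈ H := by
    intro h X hX x
    have hx := (integralBasis E).mem_span x
    induction hx using Submodule.span_induction with
    | mem x hx => obtain ⟨k, rfl⟩ := hx; exact hX k
    | zero =>
      have : formDeriv (0 : EmbSpace E →ₗ[ℝ] EmbSpace E) h = 0 := by
        simpa using formDeriv_smul 0 0 h
      rw [map_zero, this]; exact H.zero_mem
    | add x y _ _ hx hy => rw [map_add, formDeriv_add]; exact H.add_mem hx hy
    | smul c x _ hx =>
      have h1 : formDeriv (X (c • x)) h = c • formDeriv (X x) h := by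
        rw [map_rat_smul, ← Rat.cast_smul_eq_qsmul ℝ, formDeriv_smul, Rat.cast_smul_eq_qsmul]
      rw [h1]
      exact H.smul_mem _ hx
  refine ⟨hH, fun h hh x => ?_, fun h hh x => ?_⟩
  · refine hspan h ⟨⟨P.raise, ?_⟩, fun x y => ?_⟩ (fun k => (key h hh k).1) x
    · ext z : 1
      simp [GenericUnit.raise]
    · ext z : 1
      simp [GenericUnit.raise, add_mul]
  · refine hspan h ⟨⟨P.lower, ?_⟩, fun x y => ?_⟩ (fun k => (key h hh k).2) x
    · ext z : 1
      simp [GenericUnit.lower]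
    · ext z : 1
      simp [GenericUnit.lower, add_mul, mul_add]

variable {P} {L : Type} [Field L] [Algebra ℚ L] {ψ : E ⊗[ℚ] E →ₐ[ℚ] L}
  {H : Submodule ℚ (EmbSpace E [⋀^Fin 2]→ₗ[ℝ] ℂ)}

/-- A stable rational space of forms that do not all vanish on `E` contains all forms that are
induced by antisymmetric rational forms on `E` along the projection `a + i v b ↦ b`. -/
theorem IsStable.wedge_snd_snd_mem (hψ : IsPairField ψ) (hS : P.IsStable H)
    (hne : ∃ h ∈ H, ∃ x y : E, h ![P.pt x 0, P.pt y 0] ≠ 0)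
    {φ : Dual ℚ (E ⊗[ℚ] E)} (hφ : ∀ z, φ (tensorSwap E z) = -φ z) :
    wedge (bilinExt φ) P.snd P.snd ∈ H := by
  obtain ⟨h, hh, x₀, y₀, hxy⟩ := hne
  obtain ⟨χ, hχ, hχh⟩ := P.exists_restriction (hS.rational h hh)
  have hχ0 : χ ≠ 0 := by
    rintro rfl
    exact hxy (by rw [hχh, LinearMap.zero_apply, Rat.cast_zero])
  obtain ⟨r, hr⟩ := hψ.exists_eq_mul hχ hφ hχ0
  have key : ∀ r : E ⊗[ℚ] E,
      wedge (bilinExt (χ ∘ₗ LinearMap.mulLeft ℚ r)) P.snd P.snd ∈ H := by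
    intro r
    induction r with
    | zero =>
      have : bilinExt (χ ∘ₗ LinearMap.mulLeft ℚ (0 : E ⊗[ℚ] E)) = (0 : ℂ) • bilinExt χ := by
        refine LinearMap.ext_basis (canonicalEmbedding.latticeBasis E)
          (canonicalEmbedding.latticeBasis E) fun k l => ?_
        rw [canonicalEmbedding.latticeBasis_apply, canonicalEmbedding.latticeBasis_apply,
          bilinExt_apply]
        simp
      rw [this, wedge_smul, zero_smul]
      exact H.zero_mem
    | add r s hr hs =>
      have : χ ∘ₗ LinearMap.mulLeft ℚ (r + s) =
          χ ∘ₗ LinearMap.mulLeft ℚ r + χ ∘ₗ LinearMap.mulLeft ℚ s := by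
        refine LinearMap.ext fun z => ?_
        simp [add_mul]
      rw [this, bilinExt_add, wedge_add]
      exact H.add_mem hr hs
    | tmul x y =>
      have h1 : wedge (bilinExt (χ ∘ₗ LinearMap.mulLeft ℚ (x ⊗ₜ[ℚ] y))) P.snd P.snd =
          formDeriv (P.raise y) (formDeriv (P.raise x) h) := by
        refine P.form_ext_pt fun a b a' b' => ?_
        have h0 : ∀ z, h ![0, z] = 0 := fun z => by
          rw [← formBilin_apply, map_zero, LinearMap.zero_apply]
        have h0' : ∀ z, h ![z, 0] = 0 := fun z => by
          rw [← formBilin_apply, map_zero]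
        have h2 := form_swap h (P.pt (x * b') 0) (P.pt (y * b) 0)
        simp only [wedge_apply, formDeriv_apply, raise_pt, snd_pt, mul_zero, pt_zero, h0, h0',
          bilinExt_apply, hχh, LinearMap.comp_apply, LinearMap.mulLeft_apply,
          Algebra.TensorProduct.tmul_mul_tmul] at h2 ⊢
        rw [h2]
        ring
      rw [h1]
      exact hS.raise _ (hS.raise _ hh _) _
  have : φ = χ ∘ₗ LinearMap.mulLeft ℚ r := LinearMap.ext hr
  rw [this]
  exact key r

theorem antisymm_tmul {φ : Dual ℚ (E ⊗[ℚ] E)} (hφ : ∀ z, φ (tensorSwap E z) = -φ z) (x y : E) :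
    (φ (y ⊗ₜ x) : ℂ) = -φ (x ⊗ₜ y) := by
  have := hφ (x ⊗ₜ y)
  rw [Algebra.TensorProduct.comm_tmul] at this
  exact_mod_cast this

/-- The forms `φ (x a, b') - φ (x a', b)`, obtained from `φ (b, b')` by lowering. -/
theorem IsStable.wedge_mulFst_snd_mem (hS : P.IsStable H)
    (hall : ∀ φ : Dual ℚ (E ⊗[ℚ] E), (∀ z, φ (tensorSwap E z) = -φ z) →
      wedge (bilinExt φ) P.snd P.snd ∈ H)
    {φ : Dual ℚ (E ⊗[ℚ] E)} (hφ : ∀ z, φ (tensorSwap E z) = -φ z) (x : E) :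
    wedge (bilinExt φ) (mulFst x) P.snd ∈ H := by
  have h1 : formDeriv (P.lower x) (wedge (bilinExt φ) P.snd P.snd) =
      (2 : ℚ) • wedge (bilinExt φ) (mulFst x) P.snd := by
    refine P.form_ext_pt fun a b a' b' => ?_
    rw [AlternatingMap.smul_apply]
    simp only [formDeriv_apply, wedge_apply, lower_pt, snd_pt, mulFst_pt, bilinExt_apply,
      Rat.smul_def]
    rw [antisymm_tmul hφ (x * a) b', antisymm_tmul hφ (x * a') b]
    push_cast
    ring
  have h2 := H.smul_mem (1 / 2 : ℚ) (hS.lower _ (hall φ hφ) x)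
  rw [h1, smul_smul] at h2
  norm_num at h2
  exact h2

/-- The forms `φ (a, x b') - φ (a', x b)`: the sum of such a form and `φ (x a, b') - φ (x a', b)`
belongs to the antisymmetric functional `φ (x a, b) + φ (a, x b)`. -/
theorem IsStable.wedge_fst_raise_mem (hS : P.IsStable H)
    (hall : ∀ φ : Dual ℚ (E ⊗[ℚ] E), (∀ z, φ (tensorSwap E z) = -φ z) →
      wedge (bilinExt φ) P.snd P.snd ∈ H)
    {φ : Dual ℚ (E ⊗[ℚ] E)} (hφ : ∀ z, φ (tensorSwap E z) = -φ z) (x : E) :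
    wedge (bilinExt φ) fst (P.raise x) ∈ H := by
  -- the antisymmetric form `(a, b) ↦ φ (x a, b) + φ (a, x b)`
  let φ' : Dual ℚ (E ⊗[ℚ] E) := φ ∘ₗ LinearMap.mulLeft ℚ (x ⊗ₜ 1 + 1 ⊗ₜ x)
  have hφ' : ∀ z, φ' (tensorSwap E z) = -φ' z := by
    intro z
    change φ ((x ⊗ₜ 1 + 1 ⊗ₜ x) * tensorSwap E z) = -φ ((x ⊗ₜ 1 + 1 ⊗ₜ x) * z)
    rw [← hφ ((x ⊗ₜ 1 + 1 ⊗ₜ x) * z), map_mul (tensorSwap E), map_add (tensorSwap E),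
      Algebra.TensorProduct.comm_tmul, Algebra.TensorProduct.comm_tmul, add_comm (1 ⊗ₜ[ℚ] x)]
  have hval : ∀ a b : E, φ' (a ⊗ₜ b) = φ ((x * a) ⊗ₜ b) + φ (a ⊗ₜ (x * b)) := by
    intro a b
    change φ ((x ⊗ₜ 1 + 1 ⊗ₜ x) * a ⊗ₜ b) = _
    simp [add_mul]
  have h1 : wedge (bilinExt φ) fst (P.raise x) =
      wedge (bilinExt φ') (mulFst 1) P.snd - wedge (bilinExt φ) (mulFst x) P.snd := by
    refine P.form_ext_pt fun a b a' b' => ?_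
    rw [AlternatingMap.sub_apply]
    simp only [wedge_apply, raise_pt_eq_canonicalEmbedding, fst_pt, snd_pt, mulFst_pt,
      bilinExt_apply, hval, one_mul,
      Rat.cast_add]
    ring
  rw [h1]
  exact H.sub_mem (hS.wedge_mulFst_snd_mem hall hφ' 1) (hS.wedge_mulFst_snd_mem hall hφ x)

/-- The forms `φ (a, a')`, obtained from `φ (a, b') - φ (a', b)` by lowering. -/
theorem IsStable.wedge_fst_fst_mem (hS : P.IsStable H)
    (hall : ∀ φ : Dual ℚ (E ⊗[ℚ] E), (∀ z, φ (tensorSwap E z) = -φ z) →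
      wedge (bilinExt φ) P.snd P.snd ∈ H)
    {φ : Dual ℚ (E ⊗[ℚ] E)} (hφ : ∀ z, φ (tensorSwap E z) = -φ z) :
    wedge (bilinExt φ) fst fst ∈ H := by
  have h1 : wedge (bilinExt φ) fst fst =
      formDeriv (P.lower 1) (wedge (bilinExt φ) (mulFst 1) P.snd) := by
    refine P.form_ext_pt fun a b a' b' => ?_
    simp only [formDeriv_apply, wedge_apply, lower_pt, fst_pt, snd_pt, mulFst_pt, one_mul,
      map_zero, LinearMap.zero_apply]
    ring
  rw [h1]
  exact hS.lower _ (hS.wedge_mulFst_snd_mem hall hφ 1) 1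

/-- A stable rational space of forms that do not all vanish on `E` contains, after complexification,
all forms of type `(2, 0)`. -/
theorem IsStable.mem_span_of_holomorphic (hψ : IsPairField ψ) (hS : P.IsStable H)
    (hne : ∃ h ∈ H, ∃ x y : E, h ![P.pt x 0, P.pt y 0] ≠ 0)
    {ω : EmbSpace E [⋀^Fin 2]→ₗ[ℝ] ℂ}
    (hω : ∀ z z', ω ![Complex.I • z, z'] = Complex.I * ω ![z, z']) :
    ω ∈ Submodule.span ℂ (H : Set (EmbSpace E [⋀^Fin 2]→ₗ[ℝ] ℂ)) := by
  set K := Submodule.span ℂ (H : Set (EmbSpace E [⋀^Fin 2]→ₗ[ℝ] ℂ))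
  have hall : ∀ φ : Dual ℚ (E ⊗[ℚ] E), (∀ z, φ (tensorSwap E z) = -φ z) →
      wedge (bilinExt φ) P.snd P.snd ∈ H := fun φ hφ => hS.wedge_snd_snd_mem hψ hne hφ
  -- passage from rational to complex antisymmetric forms
  have hext : ∀ S T : EmbSpace E →ₗ[ℝ] EmbSpace E,
      (∀ φ : Dual ℚ (E ⊗[ℚ] E), (∀ z, φ (tensorSwap E z) = -φ z) → wedge (bilinExt φ) S T ∈ H) →
      ∀ β : EmbSpace E →ₗ[ℂ] EmbSpace E →ₗ[ℂ] ℂ, (∀ z z', β z' z = -β z z') →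
        wedge β S T ∈ K := by
    intro S T hST β hβ
    obtain ⟨J, _, c, φ, hφ, rfl⟩ := exists_eq_sum_bilinExt β hβ
    rw [wedge_sum]
    refine K.sum_mem fun j _ => ?_
    rw [wedge_smul]
    exact K.smul_mem _ (Submodule.subset_span (hST _ (hφ j)))
  obtain ⟨β, hβ⟩ := exists_bilin_of_holomorphic hω
  have hβs : ∀ z z', β z' z = -β z z' := fun z z' => by rw [hβ, hβ, form_swap]
  let β' : EmbSpace E →ₗ[ℂ] EmbSpace E →ₗ[ℂ] ℂ :=
    β.compl₁₂ (LinearMap.mulLeft ℂ P.v) (LinearMap.mulLeft ℂ P.v)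
  have h1 : wedge β fst fst ∈ K :=
    hext _ _ (fun φ hφ => hS.wedge_fst_fst_mem hall hφ) β hβs
  have h2 : ∀ k, wedge β fst (P.raise (integralBasis E k)) ∈ K := fun k =>
    hext _ _ (fun φ hφ => hS.wedge_fst_raise_mem hall hφ _) β hβs
  have h3 : wedge β' P.snd P.snd ∈ K := hext _ _ hall β' fun z z' => hβs _ _
  -- the expansion of `β (a + i v b, a' + i v b')`
  have h4 : ω = (1 / 2 : ℂ) • (wedge β fst fst - wedge β' P.snd P.snd) +
      Complex.I • ∑ k, P.vc k • wedge β fst (P.raise (integralBasis E k)) := by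
    refine form_ext fun z z' => ?_
    have hsum : ∀ z z' : EmbSpace E, ∑ k, P.vc k • β (fst z) (P.raise (integralBasis E k) z') =
        β (fst z) (P.v * P.snd z') := by
      intro z z'
      rw [v, Finset.sum_mul, map_sum]
      refine Finset.sum_congr rfl fun k _ => ?_
      rw [smul_mul_assoc, ← Complex.coe_smul, ← Complex.coe_smul, map_smul]
      rfl
    rw [AlternatingMap.add_apply, AlternatingMap.smul_apply, AlternatingMap.smul_apply,
      AlternatingMap.sub_apply, form_sum_apply]
    simp only [AlternatingMap.smul_apply, wedge_apply, smul_sub, Finset.sum_sub_distrib, hsum]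
    have hexp : ω ![z, z'] = β (fst z) (fst z') + Complex.I * β (fst z) (P.v * P.snd z') +
        Complex.I * β (P.v * P.snd z) (fst z') - β (P.v * P.snd z) (P.v * P.snd z') := by
      conv_lhs => rw [← hβ, ← P.fst_add_snd z, ← P.fst_add_snd z']
      simp only [map_add, map_smul, LinearMap.add_apply, LinearMap.smul_apply, smul_eq_mul]
      linear_combination β (P.v * P.snd z) (P.v * P.snd z') * Complex.I_mul_I
    have hβ' : ∀ z z', β' z z' = β (P.v * z) (P.v * z') := fun z z' => rfl
    rw [hexp, hβ', hβ', hβs (fst z) (fst z'), hβs (P.v * P.snd z) (P.v * P.snd z'),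
      hβs (P.v * P.snd z) (fst z')]
    simp only [smul_eq_mul]
    ring
  rw [h4]
  refine K.add_mem (K.smul_mem _ (K.sub_mem h1 h3)) (K.smul_mem _ (K.sum_mem fun k _ => ?_))
  rw [← Complex.coe_smul]
  exact K.smul_mem _ (h2 k)

/-- A rational space of forms whose complexification contains a nonzero form of type `(2, 0)` has
an element that does not vanish on `E`. -/
theorem exists_ne_zero_of_holomorphic {η : EmbSpace E [⋀^Fin 2]→ₗ[ℝ] ℂ}
    (hη : η ∈ Submodule.span ℂ (H : Set (EmbSpace E [⋀^Fin 2]→ₗ[ℝ] ℂ)))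
    (hη' : ∀ z z', η ![Complex.I • z, z'] = Complex.I * η ![z, z']) (hne : η ≠ 0) :
    ∃ h ∈ H, ∃ x y : E, h ![P.pt x 0, P.pt y 0] ≠ 0 := by
  by_contra! hcon
  apply hne
  have hη0 : ∀ x y : E, η ![P.pt x 0, P.pt y 0] = 0 := by
    intro x y
    clear hη' hne
    induction hη using Submodule.span_induction with
    | mem h hh => exact hcon h hh x y
    | zero => rfl
    | add h h' _ _ ih ih' => rw [AlternatingMap.add_apply, ih, ih', add_zero]
    | smul c h _ ih => rw [AlternatingMap.smul_apply, ih, smul_zero]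
  obtain ⟨β, hβ⟩ := exists_bilin_of_holomorphic hη'
  -- `E` spans `E ⊗ ℂ` over `ℂ`
  have hβ0 : β = 0 := by
    refine LinearMap.ext_basis (canonicalEmbedding.latticeBasis E)
      (canonicalEmbedding.latticeBasis E) fun k l => ?_
    rw [canonicalEmbedding.latticeBasis_apply, canonicalEmbedding.latticeBasis_apply, hβ]
    simpa [pt] using hη0 (integralBasis E k) (integralBasis E l)
  refine form_ext fun z z' => ?_
  rw [← hβ, hβ0]
  rfl

/-- The torus of a field `E` for which `E ⊗ E` is the product of `E` and a field is `2`-simple. -/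
theorem isTwoSimple (P : GenericUnit E) (hψ : IsPairField ψ) : P.torus.IsTwoSimple := by
  intro H hH hne
  have hS : P.IsStable H := P.isStable_of_I_stable (fun h hh => hH.1 hh)
    fun h hh => hH.formDeriv_I_mem (Submodule.subset_span hh)
  obtain ⟨η, ⟨hη, hη'⟩, hη0⟩ := (Submodule.ne_bot_iff _).1 hne
  have hne' := exists_ne_zero_of_holomorphic (P := P) (H := H) hη hη' hη0
  intro ω hω
  exact hS.mem_span_of_holomorphic hψ hne' hω

end HodgeStructures

end GenericUnit

/-! ### Units of the endomorphism ring -/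

section Units

open NumberField Module

variable {E : Type} [Field E] [NumberField E]

/-- A field whose only roots of unity are rational has the unit group `ℤ ^ d × {±1}`. -/
theorem nonempty_units_mulEquiv {d : ℕ} (hd : Units.rank E = d)
    (htors : ∀ (ζ : E) (n : ℕ), 0 < n → ζ ^ n = 1 → ∃ q : ℚ, algebraMap ℚ E q = ζ) :
    Nonempty ((𝓞 E)ˣ ≃* Multiplicative (Fin d → ℤ) × ℤˣ) := by
  subst hd
  have htors' : ∀ ζ ∈ Units.torsion E, ∃ u : ℤˣ, ζ = Units.map (Int.castRingHom (𝓞 E)) u := by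
    intro ζ hζ
    obtain ⟨n, hn, hζn⟩ := isOfFinOrder_iff_pow_eq_one.1 ((CommGroup.mem_torsion _).1 hζ)
    have h1 : ((ζ : 𝓞 E) : E) ^ n = 1 := by
      rw [← map_pow, ← Units.val_pow_eq_pow_val, hζn, Units.val_one, map_one]
    obtain ⟨q, hq⟩ := htors _ n hn h1
    have h2 : q ^ n = 1 := by
      rw [← hq, ← map_pow, ← map_one (algebraMap ℚ E)] at h1
      exact (algebraMap ℚ E).injective h1
    rcases eq_or_eq_neg_of_sq_eq_sq q 1 (by
      have h3 : |q| ^ n = 1 := by rw [← abs_pow, h2, abs_one]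
      rw [← sq_abs, (pow_eq_one_iff_of_nonneg (abs_nonneg q) hn.ne').1 h3]) with rfl | rfl
    · refine ⟨1, ?_⟩
      ext
      rw [← hq]
      simp
    · refine ⟨-1, ?_⟩
      ext
      rw [← hq]
      simp
  let f : Multiplicative (Fin (Units.rank E) → ℤ) × ℤˣ →* (𝓞 E)ˣ :=
    { toFun := fun p => Units.map (Int.castRingHom (𝓞 E)) p.2 *
        ∏ i, Units.fundSystem E i ^ (p.1.toAdd i)
      map_one' := by simp
      map_mul' := fun p q => by
        simp only [Prod.fst_mul, Prod.snd_mul, toAdd_mul, Pi.add_apply, zpow_add,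
          Finset.prod_mul_distrib, map_mul]
        exact mul_mul_mul_comm _ _ _ _ }
  have hmem : ∀ u : ℤˣ, Units.map (Int.castRingHom (𝓞 E)) u ∈ Units.torsion E := by
    intro u
    exact (CommGroup.mem_torsion _).2 <| isOfFinOrder_iff_pow_eq_one.2
      ⟨2, two_pos, by rw [← map_pow, Int.units_sq, map_one]⟩
  refine ⟨(MulEquiv.ofBijective f ⟨?_, fun x => ?_⟩).symm⟩
  · rintro ⟨e, u⟩ ⟨e', u'⟩ h
    have h1 := (Units.exist_unique_eq_mul_prod E (f (e, u))).unique
      (y₁ := (⟨_, hmem u⟩, e.toAdd)) (y₂ := (⟨_, hmem u'⟩, e'.toAdd)) rfl h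
    obtain ⟨h2, h3⟩ := Prod.ext_iff.1 h1
    have h4 : Function.Injective (Units.map (Int.castRingHom (𝓞 E) : ℤ →* 𝓞 E)) :=
      Units.map_injective (Int.castRingHom (𝓞 E)).injective_int
    rw [Prod.mk.injEq]
    exact ⟨h3, h4 (congrArg Subtype.val h2)⟩
  · obtain ⟨⟨⟨ζ, hζ⟩, e⟩, h, -⟩ := Units.exist_unique_eq_mul_prod E x
    obtain ⟨u, hu⟩ := htors' ζ hζ
    subst hu
    exact ⟨(.ofAdd e, u), h.symm⟩

end Units

theorem mainTheorem2 (g : ℕ) (hg : 3 ≤ g) :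
    (∀ r s : ℕ, r + 2 * s = g →
      ∃ T : ComplexTorus, T.dim = g ∧ T.IsTwoSimple ∧
        ∃ (E : Type) (_ : Field E) (_ : NumberField E),
          Nonempty (T.endAlg ≃ₐ[ℚ] E) ∧
          Module.finrank ℚ E = g ∧
          NumberField.InfinitePlace.nrRealPlaces E = r ∧
          NumberField.InfinitePlace.nrComplexPlaces E = s) ∧
    (∀ d : ℕ, (g : ℝ) / 2 - 1 ≤ (d : ℝ) → (d : ℝ) ≤ (g : ℝ) - 1 →
      ∃ T : ComplexTorus, T.dim = g ∧ T.IsTwoSimple ∧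
        Nonempty (T.autGroup ≃* Multiplicative (Fin d → ℤ) × ℤˣ)) := by
  constructor
  · intro r s hrs
    obtain ⟨E, _, _, L, _, _, ψ, hψ, hE, hr, hs⟩ := exists_numberField hg hrs
    obtain ⟨P⟩ := exists_genericUnit E
    exact ⟨P.torus, P.torus_dim.trans hE, P.isTwoSimple hψ, E, _, _, P.nonempty_endAlg, hE, hr, hs⟩
  · intro d hd hd'
    have h1 : g ≤ 2 * d + 2 := by
      have : (g : ℝ) ≤ 2 * d + 2 := by linarith
      exact_mod_cast this
    have h2 : d + 1 ≤ g := by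
      have : (d : ℝ) + 1 ≤ g := by linarith
      exact_mod_cast this
    -- the signature with `r + s - 1 = d`
    obtain ⟨E, _, _, L, _, _, ψ, hψ, hE, hr, hs⟩ :=
      exists_numberField (r := 2 * d + 2 - g) (s := g - 1 - d) hg (by omega)
    obtain ⟨P⟩ := exists_genericUnit E
    have hrank : NumberField.Units.rank E = d := by
      rw [NumberField.Units.rank, NumberField.InfinitePlace.card_eq_nrRealPlaces_add_nrComplexPlaces,
        hr, hs]
      omega
    obtain ⟨e⟩ := nonempty_units_mulEquiv hrank fun ζ n hn hζ => hψ.mem_range_of_pow_eq_one hn hζ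
    exact ⟨P.torus, P.torus_dim.trans hE, P.isTwoSimple hψ,
      ⟨(Units.mapEquiv P.endRingEquiv.toMulEquiv).symm.trans e⟩⟩
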